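/- **Theorem (existence and uniqueness of the energy-correction multiplier).** Let $\Omega\subset\mathbb R^d$ be a bounded open set (in particular $d=1,2,3$), and let $V$ be $H^1_0(\Omega)$ (homogeneous Dirichlet condition), $H^1(\Omega)$ (homogeneous Neumann condition) or, when $\Omega$ is a box, $H^1_{\rm per}(\Omega)$ (periodic condition), with real-valued functions; $\Delta$ is the Laplacian with the corresponding boundary condition, in the weak sense on $V$. Let $F\in C^1(\mathbb R)$, $f=F'$ and $\mathcal E[u]=\int_\Omega\big(\tfrac12|\nabla u|^2+F(u)\big)\,dx$. Let $\varphi^n\in V\cap L^\infty(\Omega)$ be the current state, and let $\Phi_\tau$ be a one-step integrator with $\Phi_\tau(\varphi^n)\in V$ such that, as $\tau\downarrow0$, $\Phi_\tau(\varphi^n)\to\varphi^n$ in $H^1(\Omega)$ and $\Phi_\tau(\varphi^n)$ stays bounded in $L^\infty(\Omega)$. Assume $$\|-\Delta\varphi^n+f(\varphi^n)\|_{L^2(\Omega)}^2\ \ge\ \tilde\epsilon>0,$$ where the norm is understood to be $+\infty$ if $-\Delta\varphi^n+f(\varphi^n)\notin L^2(\Omega)$. For $\tau>0$ consider the energy-correction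 system for $(\eta^{n+1},\varphi_*^{n+1})\in\mathbb R\times V$: $$\varphi_*^{n+1}-\Phi_\tau(\varphi^n)=-\eta^{n+1}\big[-\Delta\varphi_*^{n+1}+f(\Phi_\tau(\varphi^n))\big],$$ $$\eta^{n+1}\ge0,\qquad \mathcal E[\varphi_*^{n+1}]-\mathcal E[\varphi^n]\le0,\qquad \eta^{n+1}\big(\mathcal E[\varphi_*^{n+1}]-\mathcal E[\varphi^n]\big)=0,$$ the first equation being understood in the weak sense, i.e. tested with all $v\in V$, and with $F(\varphi_*^{n+1})$ integrable. Then there are constants $\tau_1>0$ and $\eta_{\max}>0$, independent of $\tau$, such that for every $0<\tau<\tau_1$ the system has a solution $(\eta^{n+1},\varphi_*^{n+1})$ with $0\le\eta^{n+1}\le\eta_{\max}$, and this solution is unique among all solutions with multiplier in $[0,\eta_{\max}]$. Moreover, $\eta^{n+1}=\eta^{n+1}(\tau)\to0$ as $\tau\downarrow0$. -/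

import Mathlib

open MeasureTheory Set Filter Topology
open scoped ContDiff

noncomputable section

namespace GradientFlow

/-- The Euclidean space `ℝᵈ`. -/
abbrev Space (d : ℕ) := EuclideanSpace ℝ (Fin d)

/-- Real-valued square integrable functions on `Ω`. -/
abbrev L2 {d : ℕ} (Ω : Set (Space d)) := Lp ℝ 2 (volume.restrict Ω)

/-- Square integrable vector fields on `Ω`. -/
abbrev L2Vec {d : ℕ} (Ω : Set (Space d)) := Lp (Space d) 2 (volume.restrict Ω)

/-- Pairs (function, vector field) with norm `(‖u‖² + ‖g‖²)^(1/2)`. The Sobolev spaces below consist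
of the pairs `(u, ∇u)`, so that they carry the `H¹` norm. -/
abbrev L2Pair {d : ℕ} (Ω : Set (Space d)) := WithLp 2 (L2 Ω × L2Vec Ω)

/-- Smooth functions with compact support in `Ω`. -/
def IsTestFunction {d : ℕ} (Ω : Set (Space d)) (ζ : Space d → ℝ) : Prop :=
  ContDiff ℝ ∞ ζ ∧ HasCompactSupport ζ ∧ tsupport ζ ⊆ Ω

/-- `g` is the weak gradient of `u` in `Ω`: `∫ u ∇ζ = - ∫ ζ g` for every test function `ζ`. -/
def IsWeakGradient {d : ℕ} (Ω : Set (Space d)) (u : Space d → ℝ) (g : Space d → Space d) : Prop :=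
  ∀ ζ : Space d → ℝ, IsTestFunction Ω ζ →
    ∫ x in Ω, u x • gradient ζ x = - ∫ x in Ω, ζ x • g x

theorem IsTestFunction.memLp {d : ℕ} {Ω : Set (Space d)} {ζ : Space d → ℝ}
    (h : IsTestFunction Ω ζ) : MemLp ζ 2 (volume.restrict Ω) :=
  (h.1.continuous.memLp_of_hasCompactSupport h.2.1).restrict Ω

theorem IsTestFunction.memLp_gradient {d : ℕ} {Ω : Set (Space d)} {ζ : Space d → ℝ}
    (h : IsTestFunction Ω ζ) : MemLp (gradient ζ) 2 (volume.restrict Ω) := by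
  have hc : Continuous (gradient ζ) := by
    have h1 : Continuous (fderiv ℝ ζ) := h.1.continuous_fderiv (by simp)
    exact (InnerProductSpace.toDual ℝ (Space d)).symm.continuous.comp h1
  have hs : HasCompactSupport (gradient ζ) :=
    (h.2.1.fderiv (𝕜 := ℝ)).comp_left (map_zero (InnerProductSpace.toDual ℝ (Space d)).symm)
  exact (hc.memLp_of_hasCompactSupport hs).restrict Ω

theorem integrable_smul_gradient {d : ℕ} {Ω : Set (Space d)} {ζ : Space d → ℝ}
    (h : IsTestFunction Ω ζ) (u : L2 Ω) :
    Integrable (fun x => u x • gradient ζ x) (volume.restrict Ω) :=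
  memLp_one_iff_integrable.1 (h.memLp_gradient.smul (Lp.memLp u))

theorem integrable_testFunction_smul {d : ℕ} {Ω : Set (Space d)} {ζ : Space d → ℝ}
    (h : IsTestFunction Ω ζ) (g : L2Vec Ω) :
    Integrable (fun x => ζ x • g x) (volume.restrict Ω) :=
  memLp_one_iff_integrable.1 ((Lp.memLp g).smul h.memLp)

/-- The Sobolev space `H¹(Ω)`: square integrable functions with square integrable weak gradient,
as pairs `(u, ∇u)`. -/
def sobolevH1 {d : ℕ} (Ω : Set (Space d)) : Submodule ℝ (L2Pair Ω) where
  carrier := {p | IsWeakGradient Ω p.fst p.snd}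
  zero_mem' := by
    intro ζ _
    have h1 : ∀ᵐ x ∂(volume.restrict Ω), ((0 : L2Pair Ω).fst : L2 Ω) x • gradient ζ x = 0 := by
      filter_upwards [Lp.coeFn_zero ℝ 2 (volume.restrict Ω)] with x hx
      rw [WithLp.zero_fst, hx, Pi.zero_apply, zero_smul]
    have h2 : ∀ᵐ x ∂(volume.restrict Ω), ζ x • ((0 : L2Pair Ω).snd : L2Vec Ω) x = 0 := by
      filter_upwards [Lp.coeFn_zero (Space d) 2 (volume.restrict Ω)] with x hx
      rw [WithLp.zero_snd, hx, Pi.zero_apply, smul_zero]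
    rw [integral_eq_zero_of_ae h1, integral_eq_zero_of_ae h2, neg_zero]
  add_mem' := by
    intro p q hp hq ζ hζ
    have h1 : (fun x => ((p + q).fst : L2 Ω) x • gradient ζ x) =ᵐ[volume.restrict Ω]
        fun x => p.fst x • gradient ζ x + q.fst x • gradient ζ x := by
      filter_upwards [Lp.coeFn_add p.fst q.fst] with x hx
      rw [WithLp.add_fst, hx, Pi.add_apply, add_smul]
    have h2 : (fun x => ζ x • ((p + q).snd : L2Vec Ω) x) =ᵐ[volume.restrict Ω]
        fun x => ζ x • p.snd x + ζ x • q.snd x := by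
      filter_upwards [Lp.coeFn_add p.snd q.snd] with x hx
      rw [WithLp.add_snd, hx, Pi.add_apply, smul_add]
    rw [integral_congr_ae h1, integral_congr_ae h2,
      integral_add (integrable_smul_gradient hζ _) (integrable_smul_gradient hζ _),
      integral_add (integrable_testFunction_smul hζ _) (integrable_testFunction_smul hζ _),
      hp ζ hζ, hq ζ hζ, neg_add]
  smul_mem' := by
    intro c p hp ζ hζ
    have h1 : (fun x => ((c • p).fst : L2 Ω) x • gradient ζ x) =ᵐ[volume.restrict Ω]
        fun x => c • (p.fst x • gradient ζ x) := by
      filter_upwards [Lp.coeFn_smul c p.fst] with x hx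
      rw [WithLp.smul_fst, hx, Pi.smul_apply, smul_assoc]
    have h2 : (fun x => ζ x • ((c • p).snd : L2Vec Ω) x) =ᵐ[volume.restrict Ω]
        fun x => c • (ζ x • p.snd x) := by
      filter_upwards [Lp.coeFn_smul c p.snd] with x hx
      rw [WithLp.smul_snd, hx, Pi.smul_apply, smul_comm]
    rw [integral_congr_ae h1, integral_congr_ae h2, integral_smul, integral_smul, hp ζ hζ, smul_neg]

/-- The `H¹`-closure of a class of smooth functions, viewed as pairs `(ζ, ∇ζ)` on `Ω`. -/
def smoothClosure {d : ℕ} (Ω : Set (Space d)) (core : Set (Space d → ℝ)) :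
    Submodule ℝ (L2Pair Ω) :=
  (Submodule.span ℝ {p : L2Pair Ω | ∃ ζ ∈ core,
    p.fst =ᵐ[volume.restrict Ω] ζ ∧ p.snd =ᵐ[volume.restrict Ω] gradient ζ}).topologicalClosure

/-- Smooth functions on `ℝᵈ` with period `L i` in the `i`-th coordinate. -/
def IsSmoothPeriodic {d : ℕ} (L : Fin d → ℝ) (ζ : Space d → ℝ) : Prop :=
  ContDiff ℝ ∞ ζ ∧ ∀ i x, ζ (x + EuclideanSpace.single i (L i)) = ζ x

/-- Homogeneous Dirichlet, homogeneous Neumann, or periodic boundary conditions on the box with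
lower corner `a` and side lengths `L`. -/
inductive BoundaryCondition (d : ℕ) : Type
  | dirichlet : BoundaryCondition d
  | neumann : BoundaryCondition d
  | periodic (a L : Fin d → ℝ) : BoundaryCondition d

/-- Periodic boundary conditions are imposed on their box; the two others on any domain. -/
def BoundaryCondition.Compatible {d : ℕ} (bc : BoundaryCondition d) (Ω : Set (Space d)) : Prop :=
  match bc with
  | .dirichlet => True
  | .neumann => True
  | .periodic a L => (∀ i, 0 < L i) ∧ Ω = {x | ∀ i, x i ∈ Ioo (a i) (a i + L i)}

/-- The energy space: `H¹₀(Ω)` for Dirichlet, `H¹(Ω)` for Neumann (whose condition is the natural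
one of the weak formulation), `H¹_per(Ω)` for periodic boundary conditions. -/
def energySpace {d : ℕ} (Ω : Set (Space d)) (bc : BoundaryCondition d) :
    Submodule ℝ (L2Pair Ω) :=
  match bc with
  | .dirichlet => smoothClosure Ω {ζ | IsTestFunction Ω ζ}
  | .neumann => sobolevH1 Ω
  | .periodic _ L => smoothClosure Ω {ζ | IsSmoothPeriodic L ζ}

variable {d : ℕ} {Ω : Set (Space d)} {bc : BoundaryCondition d}

/-- The function underlying an element of the energy space. -/
def fn (u : energySpace Ω bc) : L2 Ω := (u : L2Pair Ω).fst

/-- The gradient of an element of the energy space. -/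
def grad (u : energySpace Ω bc) : L2Vec Ω := (u : L2Pair Ω).snd

/-- The free energy `𝓔[u] = ∫_Ω (½ |∇u|² + F(u))`. -/
def energy (F : ℝ → ℝ) (u : energySpace Ω bc) : ℝ :=
  ∫ x in Ω, (1 / 2 * ‖grad u x‖ ^ 2 + F (fn u x))

/-- `|u| ≤ M` almost everywhere in `Ω`. -/
def BoundedBy (M : ℝ) (u : energySpace Ω bc) : Prop :=
  ∀ᵐ x ∂(volume.restrict Ω), |fn u x| ≤ M

/-- `-Δu + f(u) = r` with `r ∈ L²(Ω)`, `Δ` being the Laplacian with the boundary condition `bc`. -/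
def IsResidual (f : ℝ → ℝ) (u : energySpace Ω bc) (r : L2 Ω) : Prop :=
  ∀ v : energySpace Ω bc,
    inner ℝ (grad u) (grad v) + ∫ x in Ω, f (fn u x) * fn v x = ∫ x in Ω, r x * fn v x

/-- `‖-Δu + f(u)‖² ≥ ε`, the norm being that of `L²(Ω)`, and `+∞` if `-Δu + f(u) ∉ L²(Ω)`. -/
def ResidualSqGE (f : ℝ → ℝ) (u : energySpace Ω bc) (ε : ℝ) : Prop :=
  ∀ r : L2 Ω, IsResidual f u r → ε ≤ ‖r‖ ^ 2

/-- `(η, w)` solves the energy correction system with old state `φ` and predicted state `u`: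
`w - u = -η (-Δw + f(u))` (in weak form), `η ≥ 0`, `𝓔[w] - 𝓔[φ] ≤ 0`, `η (𝓔[w] - 𝓔[φ]) = 0`. -/
structure IsEnergyCorrection (F f : ℝ → ℝ) (φ u : energySpace Ω bc)
    (η : ℝ) (w : energySpace Ω bc) : Prop where
  equation : ∀ v : energySpace Ω bc,
    ∫ x in Ω, (fn w x - fn u x) * fn v x =
      -η * (inner ℝ (grad w) (grad v) + ∫ x in Ω, f (fn u x) * fn v x)
  integrable : IntegrableOn (fun x => F (fn w x)) Ω
  nonneg : 0 ≤ η
  energy_le : energy F w - energy F φ ≤ 0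
  complementarity : η * (energy F w - energy F φ) = 0

end GradientFlow

end

/-! Fix a predictor `u` near `φ`. For each `η ≥ 0` the linear equation `w - u = -η (-Δw + f(u))` has
exactly one solution `W η`, so the system reduces to one scalar question: where does `η ↦ energy F
(W η)` meet the level `energy F φ`? The core of the proof is that this function decreases at a rate
bounded below, uniformly in `u`, on a fixed interval `[0, ηmax]` (`exists_uniform_energy_decrease`).

Let `δ = W η₂ - W η₁` and `h = η₂ - η₁ > 0`. Subtracting the two equations and testing with `δ`
gives a drop of at least `‖δ‖² / h` in the energy with `F` linearised at `u` (`IsStep.decrease`).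
The error of linearisation is at most a small constant times `‖δ‖`: `f` is merely continuous, but on
bounded sets it has a modulus `σ + K |a - b|` with `σ` arbitrarily small
(`inner_one_nemytskii_sub_le`). Finally `‖δ‖ ≥ c h`, because the residual at `φ` is a nonzero
functional and this persists nearby (`exists_le_norm_sub_of_functional_ne_zero`). The quadratic gain
therefore beats the error and the energy falls by at least `c² h / 2`.

No growth condition is imposed on `F`, so the path must stay bounded in `L^∞`. This is a maximum
principle (`IsStep.boundedBy`), proved by testing with a smooth truncation of `w`; it requires the
chain rule for weak gradients and the stability of all three energy spaces under truncation.

As `τ → 0` the energy of the predictor tends to that of `φ`, so the intermediate value theorem gives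
the multiplier, strict decrease its uniqueness, and the rate bounds it by a multiple of the positive
part of the predictor's energy excess, which tends to zero. -/

namespace GradientFlow

/-! ### Translations and mollification in `L¹`. -/

section Mollification

variable {E : Type*} [NormedAddCommGroup E] [NormedSpace ℝ E] [FiniteDimensional ℝ E]
  [MeasurableSpace E] [BorelSpace E] {μ : Measure E} [μ.IsAddHaarMeasure]

/-- Translations act continuously on `L¹`. -/
theorem tendsto_lintegral_enorm_translate_sub {g : E → ℝ} (hg : Integrable g μ) :
    Tendsto (fun y => ∫⁻ x, ‖g (x - y) - g x‖ₑ ∂μ) (𝓝 0) (𝓝 0) := by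
  have hg1 : MemLp g 1 μ := memLp_one_iff_integrable.2 hg
  have hmp : ∀ y : E, MeasurePreserving (fun x : E => x - y) μ μ :=
    fun y => measurePreserving_sub_right μ y
  -- Currying makes the translation depend continuously on `y` in the compact-open topology, the
  -- form in which composition acts continuously on `Lp`.
  let T : C(E, C(E, E)) := ContinuousMap.curry ⟨fun p : E × E => p.2 - p.1, by fun_prop⟩
  have hT : ∀ y, MeasurePreserving (T y) μ μ := hmp
  have hc : Continuous fun y => Lp.compMeasurePreserving (T y) (hT y) (hg1.toLp g) :=
    continuous_const.compMeasurePreservingLp T.continuous hT ENNReal.one_ne_top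
  have h0 : Lp.compMeasurePreserving (T 0) (hT 0) (hg1.toLp g) = hg1.toLp g := by
    rw [Lp.toLp_compMeasurePreserving]
    congr 1
    funext x
    simp [T]
  have h1 := (EMetric.tendsto_nhds.1 (hc.tendsto 0))
  rw [h0] at h1
  rw [ENNReal.tendsto_nhds_zero]
  intro ε hε
  filter_upwards [h1 ε hε] with y hy
  rw [Lp.toLp_compMeasurePreserving, Lp.edist_toLp_toLp, eLpNorm_one_eq_lintegral_enorm] at hy
  exact hy.le

/-- Mollifications converge in `L¹`. -/
theorem tendsto_lintegral_enorm_convolution_sub {ι : Type*} {l : Filter ι}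
    {ψ : ι → ContDiffBump (0 : E)} (hψ : Tendsto (fun i => (ψ i).rOut) l (𝓝 0))
    {g : E → ℝ} (hgm : StronglyMeasurable g) (hg : Integrable g μ) :
    Tendsto (fun i => ∫⁻ x, ‖(convolution ((ψ i).normed μ) g (ContinuousLinearMap.lsmul ℝ ℝ) μ) x
      - g x‖ₑ ∂μ) l (𝓝 0) := by
  rw [ENNReal.tendsto_nhds_zero]
  intro ε hε
  obtain ⟨r, hr, hball⟩ := Metric.eventually_nhds_iff_ball.1
    (ENNReal.tendsto_nhds_zero.1 (tendsto_lintegral_enorm_translate_sub hg) ε hε)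
  filter_upwards [hψ.eventually (gt_mem_nhds hr)] with i hi
  set ρ : E → ℝ := (ψ i).normed μ with hρ
  have hρc : Continuous ρ := (ψ i).continuous_normed
  have hρs : HasCompactSupport ρ := (ψ i).hasCompactSupport_normed
  have hρn : ∀ x, 0 ≤ ρ x := (ψ i).nonneg_normed
  have hρi : ∫ x, ρ x ∂μ = 1 := (ψ i).integral_normed
  have hρint : Integrable ρ μ := hρc.integrable_of_hasCompactSupport hρs
  have hρl : ∫⁻ y, ‖ρ y‖ₑ ∂μ = 1 := by
    rw [← ofReal_integral_norm_eq_lintegral_enorm hρint]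
    simp_rw [Real.norm_of_nonneg (hρn _)]
    rw [hρi, ENNReal.ofReal_one]
  have hex : ConvolutionExists ρ g (ContinuousLinearMap.lsmul ℝ ℝ) μ :=
    hρs.convolutionExists_left _ hρc hg.locallyIntegrable
  -- Since `ρ` has mass one, the error is a `ρ`-average of translation differences. After Tonelli
  -- only translations by vectors in the support of `ρ` matter, and these are small in `L¹`.
  have hpt : ∀ x, ‖(convolution ρ g (ContinuousLinearMap.lsmul ℝ ℝ) μ) x - g x‖ₑ
      ≤ ∫⁻ y, ‖ρ y‖ₑ * ‖g (x - y) - g x‖ₑ ∂μ := by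
    intro x
    have h1 : (convolution ρ g (ContinuousLinearMap.lsmul ℝ ℝ) μ) x - g x
        = ∫ y, ρ y * (g (x - y) - g x) ∂μ := by
      have h2 : g x = ∫ y, ρ y * g x ∂μ := by rw [integral_mul_const, hρi, one_mul]
      conv_lhs => rw [h2]
      rw [convolution_def, ← integral_sub (hex x) (hρint.mul_const _)]
      simp [mul_sub]
    rw [h1]
    refine (enorm_integral_le_lintegral_enorm _).trans (le_of_eq ?_)
    simp_rw [enorm_mul]
  have hm : Measurable fun p : E × E => ‖ρ p.2‖ₑ * ‖g (p.1 - p.2) - g p.1‖ₑ := by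
    have h1 : Measurable g := hgm.measurable
    have h2 : Measurable ρ := hρc.measurable
    fun_prop
  calc ∫⁻ x, ‖(convolution ρ g (ContinuousLinearMap.lsmul ℝ ℝ) μ) x - g x‖ₑ ∂μ
      ≤ ∫⁻ x, ∫⁻ y, ‖ρ y‖ₑ * ‖g (x - y) - g x‖ₑ ∂μ ∂μ := lintegral_mono hpt
    _ = ∫⁻ y, ∫⁻ x, ‖ρ y‖ₑ * ‖g (x - y) - g x‖ₑ ∂μ ∂μ :=
        lintegral_lintegral_swap hm.aemeasurable
    _ = ∫⁻ y, ‖ρ y‖ₑ * ∫⁻ x, ‖g (x - y) - g x‖ₑ ∂μ ∂μ := by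
        refine lintegral_congr fun y => ?_
        rw [lintegral_const_mul']
        exact enorm_ne_top
    _ ≤ ∫⁻ y, ‖ρ y‖ₑ * ε ∂μ := by
        refine lintegral_mono fun y => ?_
        by_cases hy : ρ y = 0
        · simp [hy]
        · have hy' : y ∈ Function.support ρ := hy
          rw [hρ, (ψ i).support_normed_eq] at hy'
          exact mul_le_mul_right (hball y (Metric.ball_subset_ball hi.le hy')) _
    _ = ε := by rw [lintegral_mul_const _ (by fun_prop), hρl, one_mul]

end Mollification

end GradientFlow

/-! ### The chain rule for weak gradients. -/

namespace GradientFlow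

theorem tendsto_integral_mul_of_tendsto_lintegral {α ι : Type*} [MeasurableSpace α] {μ : Measure α}
    {l : Filter ι} {c h : ι → α → ℝ} {C : ℝ} (hc : ∀ i x, |c i x| ≤ C)
    (hh : Tendsto (fun i => ∫⁻ x, ‖h i x‖ₑ ∂μ) l (𝓝 0)) :
    Tendsto (fun i => ∫ x, c i x * h i x ∂μ) l (𝓝 0) := by
  rw [tendsto_zero_iff_enorm_tendsto_zero]
  have h1 : Tendsto (fun i => ENNReal.ofReal C * ∫⁻ x, ‖h i x‖ₑ ∂μ) l (𝓝 0) := by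
    simpa using ENNReal.Tendsto.const_mul hh (Or.inr ENNReal.ofReal_ne_top)
  refine tendsto_of_tendsto_of_tendsto_of_le_of_le tendsto_const_nhds h1 (fun _ => zero_le) ?_
  intro i
  beta_reduce
  refine (enorm_integral_le_lintegral_enorm _).trans ?_
  rw [← lintegral_const_mul' _ _ ENNReal.ofReal_ne_top]
  refine lintegral_mono fun x => ?_
  rw [enorm_mul]
  gcongr
  rw [← ofReal_norm]
  exact ENNReal.ofReal_le_ofReal (hc i x)

variable {d : ℕ} {Ω : Set (Space d)}

theorem IsTestFunction.continuous_fderiv_apply {ζ : Space d → ℝ} (h : IsTestFunction Ω ζ)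
    (e : Space d) : Continuous fun x => fderiv ℝ ζ x e :=
  (h.1.continuous_fderiv (by simp)).clm_apply continuous_const

theorem IsTestFunction.hasCompactSupport_fderiv_apply {ζ : Space d → ℝ} (h : IsTestFunction Ω ζ)
    (e : Space d) : HasCompactSupport fun x => fderiv ℝ ζ x e :=
  (h.2.1.fderiv (𝕜 := ℝ)).comp_left (g := fun A : Space d →L[ℝ] ℝ => A e) (by simp)

/-- The weak gradient, component by component. -/
theorem isWeakGradient_iff {u : Space d → ℝ} {g : Space d → Space d}
    (hu : IntegrableOn u Ω) (hg : IntegrableOn g Ω) :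
    IsWeakGradient Ω u g ↔ ∀ ζ : Space d → ℝ, IsTestFunction Ω ζ → ∀ e : Space d,
      ∫ x in Ω, u x * fderiv ℝ ζ x e = - ∫ x in Ω, ζ x * inner ℝ e (g x) := by
  refine forall₂_congr fun ζ hζ => ?_
  have hc : Continuous (gradient ζ) :=
    (InnerProductSpace.toDual ℝ (Space d)).symm.continuous.comp
      (hζ.1.continuous_fderiv (by simp))
  have hs : HasCompactSupport (gradient ζ) :=
    (hζ.2.1.fderiv (𝕜 := ℝ)).comp_left (map_zero (InnerProductSpace.toDual ℝ (Space d)).symm)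
  obtain ⟨C, hC⟩ := hs.exists_bound_of_continuous hc
  obtain ⟨C', hC'⟩ := hζ.2.1.exists_bound_of_continuous hζ.1.continuous
  have h1 : Integrable (fun x => u x • gradient ζ x) (volume.restrict Ω) :=
    Integrable.smul_bdd hu C hc.aestronglyMeasurable (ae_of_all _ hC)
  have h2 : Integrable (fun x => ζ x • g x) (volume.restrict Ω) :=
    Integrable.bdd_smul hg C' hζ.1.continuous.aestronglyMeasurable (ae_of_all _ hC')
  have e1 : ∀ e, ∫ x in Ω, u x * fderiv ℝ ζ x e = inner ℝ e (∫ x in Ω, u x • gradient ζ x) := by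
    intro e
    rw [← integral_inner h1]
    congr 1
    funext x
    rw [inner_smul_right, real_inner_comm, inner_gradient_left]
  have e2 : ∀ e, ∫ x in Ω, ζ x * inner ℝ e (g x) = inner ℝ e (∫ x in Ω, ζ x • g x) := by
    intro e
    rw [← integral_inner h2]
    simp_rw [inner_smul_right]
  simp_rw [e1, e2, ← inner_neg_right]
  exact ⟨fun h e => by rw [h], fun h => ext_inner_left ℝ h⟩

/-- Away from the boundary, the derivative of a mollification is the mollification of the weak
gradient. -/
theorem IsWeakGradient.fderiv_convolution (hΩ : IsOpen Ω) {u : Space d → ℝ} {g : Space d → Space d}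
    (hu : IntegrableOn u Ω) (hg : IntegrableOn g Ω) (h : IsWeakGradient Ω u g)
    (ψ : ContDiffBump (0 : Space d)) {x : Space d} (hx : Metric.closedBall x ψ.rOut ⊆ Ω)
    (e : Space d) :
    fderiv ℝ (convolution (ψ.normed volume) (Ω.indicator u) (ContinuousLinearMap.lsmul ℝ ℝ)
      volume) x e = convolution (ψ.normed volume) (Ω.indicator fun y => inner ℝ e (g y))
      (ContinuousLinearMap.lsmul ℝ ℝ) volume x := by
  set ρ : Space d → ℝ := ψ.normed volume with hρ
  have hρ1 : ContDiff ℝ ∞ ρ := ψ.contDiff_normed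
  have hρs : HasCompactSupport ρ := ψ.hasCompactSupport_normed
  have hU : LocallyIntegrable (Ω.indicator u) :=
    ((integrable_indicator_iff hΩ.measurableSet).2 hu).locallyIntegrable
  have hd := hρs.hasFDerivAt_convolution_right (ContinuousLinearMap.lsmul ℝ ℝ).flip hU
    (hρ1.of_le (by simp)) x
  rw [convolution_flip] at hd
  rw [hd.fderiv, convolution_precompR_apply _ hU (hρs.fderiv ℝ)
    (hρ1.continuous_fderiv (by simp)), convolution_def, convolution_eq_swap]
  -- The kernel centred at `x` is itself admissible, since its support lies in the closed ball
  -- contained in `Ω`; the weak gradient identity for it is the claim.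
  have htest : IsTestFunction Ω fun y => ρ (x - y) := by
    have hemb : Topology.IsClosedEmbedding fun y : Space d => x - y :=
      (Homeomorph.subLeft x).isClosedEmbedding
    refine ⟨hρ1.comp (by fun_prop), hρs.comp_isClosedEmbedding hemb, ?_⟩
    refine Subset.trans ?_ hx
    refine closure_minimal (fun y hy => ?_) Metric.isClosed_closedBall
    have hy' : x - y ∈ Function.support ρ := hy
    rw [hρ, ψ.support_normed_eq, mem_ball_zero_iff] at hy'
    rw [Metric.mem_closedBall, dist_eq_norm, norm_sub_rev]
    exact hy'.le
  have key := (isWeakGradient_iff hu hg).1 h _ htest e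
  have hdρ : ∀ y, fderiv ℝ (fun y => ρ (x - y)) y e = - fderiv ℝ ρ (x - y) e := by
    intro y
    have h1 : HasFDerivAt (fun y : Space d => x - y) (-ContinuousLinearMap.id ℝ (Space d)) y :=
      (hasFDerivAt_id y).const_sub x
    have h2 := ((hρ1.differentiable (by simp)) (x - y)).hasFDerivAt.comp y h1
    have h3 : fderiv ℝ (fun y => ρ (x - y)) y = _ := h2.fderiv
    rw [h3]
    simp
  simp_rw [hdρ, mul_neg, integral_neg, neg_inj] at key
  rw [← integral_indicator hΩ.measurableSet, ← integral_indicator hΩ.measurableSet] at key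
  refine (integral_congr_ae (ae_of_all _ fun y => ?_)).trans
    (key.trans (integral_congr_ae (ae_of_all _ fun y => ?_)))
  · by_cases hy : y ∈ Ω <;> simp [hy, mul_comm]
  · by_cases hy : y ∈ Ω <;> simp [hy]

/-- Chain rule for weak gradients. -/
theorem IsWeakGradient.comp (hΩ : IsOpen Ω) {u : Space d → ℝ} {g : Space d → Space d}
    (hgm : StronglyMeasurable g)
    (hu : IntegrableOn u Ω) (hg : IntegrableOn g Ω) (h : IsWeakGradient Ω u g)
    {G : ℝ → ℝ} (hG : ContDiff ℝ ∞ G) {C : ℝ} (hC : ∀ s, |G s| ≤ C) (hC' : ∀ s, |deriv G s| ≤ C)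
    (hGu : IntegrableOn (fun x => G (u x)) Ω)
    (hGg : IntegrableOn (fun x => deriv G (u x) • g x) Ω) :
    IsWeakGradient Ω (fun x => G (u x)) fun x => deriv G (u x) • g x := by
  rw [isWeakGradient_iff hGu hGg]
  intro ζ hζ e
  -- Extension by zero may destroy weak differentiability across the boundary. This is harmless:
  -- derivatives of the mollified function are used only on the support of `ζ`, at positive distance
  -- from the complement of `Ω`.
  set U : Space d → ℝ := Ω.indicator u
  set Q : Space d → ℝ := Ω.indicator fun y => inner ℝ e (g y)
  have hUi : Integrable U := (integrable_indicator_iff hΩ.measurableSet).2 hu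
  have hQi : Integrable Q := (integrable_indicator_iff hΩ.measurableSet).2 (hg.const_inner e)
  have hQm : StronglyMeasurable Q := (stronglyMeasurable_const.inner hgm).indicator hΩ.measurableSet
  have hG'c : Continuous (deriv G) := hG.continuous_deriv (by simp)
  obtain ⟨Z, hZ⟩ := hζ.2.1.exists_bound_of_continuous hζ.1.continuous
  have hdζint : Integrable fun x => fderiv ℝ ζ x e :=
    (hζ.continuous_fderiv_apply e).integrable_of_hasCompactSupport
      (hζ.hasCompactSupport_fderiv_apply e)
  have hζ0 : ∀ x ∉ Ω, ζ x = 0 := fun x hx => image_eq_zero_of_notMem_tsupport fun h => hx (hζ.2.2 h)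
  have hdζ0 : ∀ x ∉ Ω, fderiv ℝ ζ x e = 0 := fun x hx => by
    have : fderiv ℝ ζ x = 0 := by
      by_contra hne
      exact hx (hζ.2.2 (support_fderiv_subset ℝ hne))
    rw [this]; rfl
  -- The fixed ratio 2 of outer to inner radius is what the almost everywhere convergence of
  -- mollifications requires.
  let ψ : ℕ → ContDiffBump (0 : Space d) := fun n =>
    ⟨1 / (n + 1 : ℝ), 2 / (n + 1 : ℝ), by positivity, by gcongr; norm_num⟩
  have hψ : Tendsto (fun n => (ψ n).rOut) atTop (𝓝 0) := by
    have := (tendsto_one_div_add_atTop_nhds_zero_nat (𝕜 := ℝ)).const_mul 2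
    simpa [ψ, div_eq_mul_inv] using this
  let w : ℕ → Space d → ℝ := fun n =>
    convolution ((ψ n).normed volume) U (ContinuousLinearMap.lsmul ℝ ℝ) volume
  let q : ℕ → Space d → ℝ := fun n =>
    convolution ((ψ n).normed volume) Q (ContinuousLinearMap.lsmul ℝ ℝ) volume
  have hw1 : ∀ n, ContDiff ℝ ∞ (w n) := fun n =>
    ((ψ n).hasCompactSupport_normed).contDiff_convolution_left _ (ψ n).contDiff_normed
      hUi.locallyIntegrable
  have hwae : ∀ᵐ x, Tendsto (fun n => w n x) atTop (𝓝 (U x)) :=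
    ContDiffBump.ae_convolution_tendsto_right_of_locallyIntegrable (K := 2) hψ
      (Eventually.of_forall fun n => by simp [ψ, div_eq_mul_inv])
      hUi.locallyIntegrable
  have hqL : Tendsto (fun n => ∫⁻ x, ‖q n x - Q x‖ₑ) atTop (𝓝 0) :=
    tendsto_lintegral_enorm_convolution_sub hψ hQm hQi
  have hqi : ∀ n, Integrable (q n) := fun n =>
    Integrable.integrable_convolution _
      ((ψ n).continuous_normed.integrable_of_hasCompactSupport (ψ n).hasCompactSupport_normed) hQi
  obtain ⟨r, hr, hrΩ⟩ := hζ.2.1.isCompact.exists_cthickening_subset_open hΩ hζ.2.2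
  -- integration by parts for the mollified functions
  have hparts : ∀ᶠ n in atTop, ∫ x, G (w n x) * fderiv ℝ ζ x e
      = - ∫ x, (ζ x * deriv G (w n x)) * q n x := by
    filter_upwards [hψ.eventually (gt_mem_nhds hr)] with n hn
    have hGw : ContDiff ℝ ∞ fun x => G (w n x) := hG.comp (hw1 n)
    have hdc : Continuous fun x => fderiv ℝ (fun x => G (w n x)) x e :=
      (hGw.continuous_fderiv (by simp)).clm_apply continuous_const
    rw [integral_mul_fderiv_eq_neg_fderiv_mul_of_integrable]
    · congr 1
      refine integral_congr_ae (ae_of_all _ fun x => ?_)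
      by_cases hx : x ∈ tsupport ζ
      · have hball : Metric.closedBall x (ψ n).rOut ⊆ Ω :=
          ((Metric.closedBall_subset_closedBall hn.le).trans
            (Metric.closedBall_subset_cthickening hx r)).trans hrΩ
        have h1 := h.fderiv_convolution hΩ hu hg (ψ n) hball e
        have h2 : HasFDerivAt (fun x => G (w n x)) (deriv G (w n x) • fderiv ℝ (w n) x) x :=
          ((hG.differentiable (by simp)) (w n x)).hasDerivAt.comp_hasFDerivAt x
            ((hw1 n).differentiable (by simp) x).hasFDerivAt
        have h3 : fderiv ℝ (w n) x e = q n x := h1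
        simp only [h2.fderiv, _root_.smul_apply, h3, smul_eq_mul]
        ring
      · simp [image_eq_zero_of_notMem_tsupport hx]
    · exact (hdc.mul hζ.1.continuous).integrable_of_hasCompactSupport hζ.2.1.mul_left
    · exact (hGw.continuous.mul (hζ.continuous_fderiv_apply e)).integrable_of_hasCompactSupport
        (hζ.hasCompactSupport_fderiv_apply e).mul_left
    · exact (hGw.continuous.mul hζ.1.continuous).integrable_of_hasCompactSupport hζ.2.1.mul_left
    · exact fun x _ => hGw.differentiable (by simp) x
    · exact fun x _ => hζ.1.differentiable (by simp) x
  have hL : Tendsto (fun n => ∫ x, G (w n x) * fderiv ℝ ζ x e) atTop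
      (𝓝 (∫ x, G (U x) * fderiv ℝ ζ x e)) := by
    refine tendsto_integral_of_dominated_convergence (fun x => C * ‖fderiv ℝ ζ x e‖) ?_
      (hdζint.norm.const_mul C) ?_ ?_
    · exact fun n => ((hG.continuous.comp (hw1 n).continuous).mul
        (hζ.continuous_fderiv_apply e)).aestronglyMeasurable
    · refine fun n => ae_of_all _ fun x => ?_
      rw [norm_mul]
      gcongr
      exact hC _
    · filter_upwards [hwae] with x hx
      exact ((hG.continuous.tendsto _).comp hx).mul_const _
  have hcb : ∀ n x, |ζ x * deriv G (w n x)| ≤ Z * C := fun n x => by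
    rw [abs_mul]
    exact mul_le_mul (hZ x) (hC' _) (abs_nonneg _) ((norm_nonneg _).trans (hZ x))
  have hcm : ∀ n, AEStronglyMeasurable (fun x => ζ x * deriv G (w n x)) :=
    fun n => (hζ.1.continuous.mul (hG'c.comp (hw1 n).continuous)).aestronglyMeasurable
  -- The factor `deriv G (w n)` is bounded and converges only almost everywhere, while `q n`
  -- converges in `L¹`. Writing `q n = (q n - Q) + Q` leaves a bounded factor times an `L¹` null
  -- sequence, and a dominated term.
  have hR1 : Tendsto (fun n => ∫ x, (ζ x * deriv G (w n x)) * (q n x - Q x)) atTop (𝓝 0) :=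
    tendsto_integral_mul_of_tendsto_lintegral hcb hqL
  have hR2 : Tendsto (fun n => ∫ x, (ζ x * deriv G (w n x)) * Q x) atTop
      (𝓝 (∫ x, (ζ x * deriv G (U x)) * Q x)) := by
    refine tendsto_integral_of_dominated_convergence (fun x => Z * C * ‖Q x‖) ?_
      (hQi.norm.const_mul _) ?_ ?_
    · exact fun n => (hcm n).mul hQm.aestronglyMeasurable
    · refine fun n => ae_of_all _ fun x => ?_
      rw [norm_mul]
      gcongr
      exact hcb n x
    · filter_upwards [hwae] with x hx
      exact ((((hG'c.tendsto _).comp hx).const_mul _).mul_const _)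
  have hR : Tendsto (fun n => ∫ x, (ζ x * deriv G (w n x)) * q n x) atTop
      (𝓝 (∫ x, (ζ x * deriv G (U x)) * Q x)) := by
    have := hR1.add hR2
    rw [zero_add] at this
    refine this.congr fun n => ?_
    rw [← integral_add]
    · congr 1
      funext x
      ring
    · exact ((hqi n).sub hQi).bdd_mul (hcm n) (ae_of_all _ (hcb n))
    · exact hQi.bdd_mul (hcm n) (ae_of_all _ (hcb n))
  have hfin := tendsto_nhds_unique (hL.congr' hparts) hR.neg
  rw [← integral_indicator hΩ.measurableSet, ← integral_indicator hΩ.measurableSet]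
  refine (integral_congr_ae (ae_of_all _ fun x => ?_)).trans
    (hfin.trans (congrArg Neg.neg (integral_congr_ae (ae_of_all _ fun x => ?_))))
  · by_cases hx : x ∈ Ω
    · simp [hx, U]
    · simp [hx, hdζ0 x hx]
  · by_cases hx : x ∈ Ω
    · simp [hx, U, Q, inner_smul_right, mul_assoc]
    · simp [hx, hζ0 x hx]

end GradientFlow

/-! ### The energy spaces: closedness, uniqueness of gradients, stability under truncation. -/

namespace GradientFlow

variable {d : ℕ} {Ω : Set (Space d)} {bc : BoundaryCondition d}

theorem integrableOn_of_L2 [IsFiniteMeasure (volume.restrict Ω)] {H : Type*}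
    [NormedAddCommGroup H] (u : Lp H 2 (volume.restrict Ω)) : IntegrableOn u Ω :=
  (Lp.memLp u).integrable one_le_two

/-- For each test function and direction, the weak gradient identity equates two continuous linear
functionals, namely inner products with fixed `L²` elements. -/
theorem isClosed_sobolevH1 [IsFiniteMeasure (volume.restrict Ω)] :
    IsClosed (sobolevH1 Ω : Set (L2Pair Ω)) := by
  have hset : (sobolevH1 Ω : Set (L2Pair Ω)) = ⋂ (ζ : Space d → ℝ) (_ : IsTestFunction Ω ζ)
      (e : Space d), {p : L2Pair Ω | ∫ x in Ω, p.fst x * fderiv ℝ ζ x e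
        = - ∫ x in Ω, ζ x * inner ℝ e (p.snd x)} := by
    ext p
    simp only [mem_iInter, mem_ofPred_eq]
    exact isWeakGradient_iff (integrableOn_of_L2 p.fst) (integrableOn_of_L2 p.snd)
  rw [hset]
  refine isClosed_iInter fun ζ => isClosed_iInter fun hζ => isClosed_iInter fun e => ?_
  have h1 : MemLp (fun x => fderiv ℝ ζ x e) 2 (volume.restrict Ω) :=
    ((hζ.continuous_fderiv_apply e).memLp_of_hasCompactSupport
      (hζ.hasCompactSupport_fderiv_apply e)).restrict Ω
  have h2 : MemLp (fun x => ζ x • e) 2 (volume.restrict Ω) :=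
    ((hζ.1.continuous.smul continuous_const).memLp_of_hasCompactSupport
      hζ.2.1.smul_right).restrict Ω
  have e1 : ∀ p : L2Pair Ω, ∫ x in Ω, p.fst x * fderiv ℝ ζ x e = inner ℝ (h1.toLp _) p.fst := by
    intro p
    rw [L2.inner_def]
    refine integral_congr_ae ?_
    filter_upwards [h1.coeFn_toLp] with x hx
    rw [hx]
    simp
  have e2 : ∀ p : L2Pair Ω, ∫ x in Ω, ζ x * inner ℝ e (p.snd x) = inner ℝ (h2.toLp _) p.snd := by
    intro p
    rw [L2.inner_def]
    refine integral_congr_ae ?_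
    filter_upwards [h2.coeFn_toLp] with x hx
    rw [hx, real_inner_smul_left]
  simp_rw [e1, e2]
  have c1 : Continuous fun p : L2Pair Ω => p.fst := WithLp.continuous_fst 2 _ _
  have c2 : Continuous fun p : L2Pair Ω => p.snd := WithLp.continuous_snd 2 _ _
  exact isClosed_eq (continuous_const.inner c1) (continuous_const.inner c2).neg

/-- Classical gradients are weak gradients. -/
theorem isWeakGradient_gradient {w : Space d → ℝ} (hw : ContDiff ℝ ∞ w)
    (hwi : IntegrableOn w Ω) (hgi : IntegrableOn (gradient w) Ω) :
    IsWeakGradient Ω w (gradient w) := by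
  rw [isWeakGradient_iff hwi hgi]
  intro ζ hζ e
  have hζ0 : ∀ x ∉ Ω, ζ x = 0 := fun x hx => image_eq_zero_of_notMem_tsupport fun h => hx (hζ.2.2 h)
  have hdζ0 : ∀ x ∉ Ω, fderiv ℝ ζ x e = 0 := fun x hx => by
    have : fderiv ℝ ζ x = 0 := by
      by_contra hne
      exact hx (hζ.2.2 (support_fderiv_subset ℝ hne))
    rw [this]; rfl
  have hdc : Continuous fun x => fderiv ℝ w x e :=
    (hw.continuous_fderiv (by simp)).clm_apply continuous_const
  rw [setIntegral_eq_integral_of_forall_compl_eq_zero fun x hx => by rw [hdζ0 x hx, mul_zero],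
    setIntegral_eq_integral_of_forall_compl_eq_zero fun x hx => by rw [hζ0 x hx, zero_mul],
    integral_mul_fderiv_eq_neg_fderiv_mul_of_integrable]
  · congr 1
    refine integral_congr_ae (ae_of_all _ fun x => ?_)
    simp only
    rw [real_inner_comm, inner_gradient_left, mul_comm]
  · exact (hdc.mul hζ.1.continuous).integrable_of_hasCompactSupport hζ.2.1.mul_left
  · exact (hw.continuous.mul (hζ.continuous_fderiv_apply e)).integrable_of_hasCompactSupport
      (hζ.hasCompactSupport_fderiv_apply e).mul_left
  · exact (hw.continuous.mul hζ.1.continuous).integrable_of_hasCompactSupport hζ.2.1.mul_left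
  · exact fun x _ => hw.differentiable (by simp) x
  · exact fun x _ => hζ.1.differentiable (by simp) x

theorem IsWeakGradient.congr_ae {u u' : Space d → ℝ} {g g' : Space d → Space d}
    (h : IsWeakGradient Ω u g) (hu : u' =ᵐ[volume.restrict Ω] u)
    (hg : g' =ᵐ[volume.restrict Ω] g) : IsWeakGradient Ω u' g' := by
  intro ζ hζ
  have h1 : ∫ x in Ω, u' x • gradient ζ x = ∫ x in Ω, u x • gradient ζ x := by
    refine integral_congr_ae ?_
    filter_upwards [hu] with x hx
    rw [hx]
  have h2 : ∫ x in Ω, ζ x • g' x = ∫ x in Ω, ζ x • g x := by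
    refine integral_congr_ae ?_
    filter_upwards [hg] with x hx
    rw [hx]
  rw [h1, h2, h ζ hζ]

theorem smoothClosure_le_sobolevH1 [IsFiniteMeasure (volume.restrict Ω)]
    {core : Set (Space d → ℝ)} (hcore : ∀ ζ ∈ core, ContDiff ℝ ∞ ζ) :
    smoothClosure Ω core ≤ sobolevH1 Ω := by
  refine Submodule.topologicalClosure_minimal _ (Submodule.span_le.2 ?_) isClosed_sobolevH1
  rintro p ⟨ζ, hζ, h1, h2⟩
  exact (isWeakGradient_gradient (hcore ζ hζ) ((integrableOn_of_L2 p.fst).congr h1)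
    ((integrableOn_of_L2 p.snd).congr h2)).congr_ae h1 h2

theorem energySpace_le_sobolevH1 [IsFiniteMeasure (volume.restrict Ω)] :
    energySpace Ω bc ≤ sobolevH1 Ω := by
  cases bc with
  | dirichlet => exact smoothClosure_le_sobolevH1 fun ζ hζ => hζ.1
  | neumann => exact le_rfl
  | periodic a L => exact smoothClosure_le_sobolevH1 fun ζ hζ => hζ.1

theorem isClosed_energySpace [IsFiniteMeasure (volume.restrict Ω)] :
    IsClosed (energySpace Ω bc : Set (L2Pair Ω)) := by
  cases bc with
  | dirichlet => exact Submodule.isClosed_topologicalClosure _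
  | neumann => exact isClosed_sobolevH1
  | periodic a L => exact Submodule.isClosed_topologicalClosure _

/-- An element of `H¹` is determined by its function: weak gradients are unique. -/
theorem sobolevH1_eq_zero [IsFiniteMeasure (volume.restrict Ω)] (hΩ : IsOpen Ω) {p : L2Pair Ω}
    (hp : p ∈ sobolevH1 Ω) (h0 : p.fst = 0) : p = 0 := by
  have hw : IsWeakGradient Ω p.fst p.snd := hp
  have hg : ∀ᵐ x, x ∈ Ω → (p.snd : Space d → Space d) x = 0 := by
    refine hΩ.ae_eq_zero_of_integral_contDiff_smul_eq_zero
      (integrableOn_of_L2 p.snd).locallyIntegrableOn fun ζ h1 h2 h3 => ?_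
    have hζ : IsTestFunction Ω ζ := ⟨h1, h2, h3⟩
    rw [← setIntegral_eq_integral_of_forall_compl_eq_zero (s := Ω) fun x hx => by
      rw [image_eq_zero_of_notMem_tsupport fun h => hx (h3 h), zero_smul]]
    have h4 := hw ζ hζ
    rw [h0] at h4
    rw [← neg_eq_zero, ← h4]
    refine integral_eq_zero_of_ae ?_
    filter_upwards [Lp.coeFn_zero ℝ 2 (volume.restrict Ω)] with x hx
    rw [hx]
    simp
  have hs : p.snd = 0 := by
    refine Lp.ext ?_
    filter_upwards [(ae_restrict_iff' hΩ.measurableSet).2 hg,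
      Lp.coeFn_zero (Space d) 2 (volume.restrict Ω)] with x hx hx0
    rw [hx, hx0]
    rfl
  exact WithLp.ofLp_injective 2 (Prod.ext h0 hs)

/-- This is the hypothesis `hinj` of the abstract step below; it yields uniqueness of the step and
density of the range of the adjoint embedding. -/
theorem fn_injective [IsFiniteMeasure (volume.restrict Ω)] (hΩ : IsOpen Ω)
    {u : energySpace Ω bc} (h : fn u = 0) : u = 0 :=
  Subtype.ext (sobolevH1_eq_zero hΩ (energySpace_le_sobolevH1 u.2) h)

/-- Smooth bounded functions with bounded derivative, vanishing at zero. -/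
structure IsSmoothCutoff (G : ℝ → ℝ) (C : ℝ) : Prop where
  contDiff : ContDiff ℝ ∞ G
  zero : G 0 = 0
  bound : ∀ s, |G s| ≤ C
  bound_deriv : ∀ s, |deriv G s| ≤ C

theorem IsSmoothCutoff.nonneg {G : ℝ → ℝ} {C : ℝ} (hG : IsSmoothCutoff G C) : 0 ≤ C :=
  (abs_nonneg _).trans (hG.bound 0)

theorem IsSmoothCutoff.continuous_deriv {G : ℝ → ℝ} {C : ℝ} (hG : IsSmoothCutoff G C) :
    Continuous (deriv G) :=
  hG.contDiff.continuous_deriv (by simp)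

theorem IsSmoothCutoff.abs_sub_le {G : ℝ → ℝ} {C : ℝ} (hG : IsSmoothCutoff G C) (a b : ℝ) :
    |G a - G b| ≤ C * |a - b| := by
  simpa using Convex.norm_image_sub_le_of_norm_deriv_le (s := univ) (x := b) (y := a)
    (fun x _ => hG.contDiff.differentiable (by simp) x) (fun x _ => hG.bound_deriv x)
    convex_univ (mem_univ _) (mem_univ _)

/-- `q = G(p)` with the gradient prescribed by the chain rule. -/
def IsComp (G : ℝ → ℝ) (p q : L2Pair Ω) : Prop :=
  (q.fst =ᵐ[volume.restrict Ω] fun x => G (p.fst x)) ∧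
    q.snd =ᵐ[volume.restrict Ω] fun x => deriv G (p.fst x) • p.snd x

theorem IsSmoothCutoff.exists_isComp [IsFiniteMeasure (volume.restrict Ω)] {G : ℝ → ℝ} {C : ℝ}
    (hG : IsSmoothCutoff G C) (p : L2Pair Ω) : ∃ q : L2Pair Ω, IsComp G p q := by
  have hm := (Lp.memLp p.fst).aestronglyMeasurable
  have h1 : MemLp (fun x => G (p.fst x)) 2 (volume.restrict Ω) :=
    MemLp.of_bound (hG.contDiff.continuous.comp_aestronglyMeasurable hm) C
      (ae_of_all _ fun x => hG.bound _)
  have h2 : MemLp (fun x => deriv G (p.fst x) • p.snd x) 2 (volume.restrict Ω) := by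
    refine MemLp.of_le_mul (c := C) (Lp.memLp p.snd)
      ((hG.continuous_deriv.comp_aestronglyMeasurable hm).smul
        (Lp.memLp p.snd).aestronglyMeasurable) (ae_of_all _ fun x => ?_)
    rw [norm_smul]
    gcongr
    exact hG.bound_deriv _
  exact ⟨WithLp.toLp 2 (h1.toLp _, h2.toLp _), h1.coeFn_toLp, h2.coeFn_toLp⟩

theorem IsComp.mem_sobolevH1 [IsFiniteMeasure (volume.restrict Ω)] (hΩ : IsOpen Ω) {G : ℝ → ℝ}
    {C : ℝ} (hG : IsSmoothCutoff G C) {p q : L2Pair Ω} (hp : p ∈ sobolevH1 Ω) (h : IsComp G p q) :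
    q ∈ sobolevH1 Ω := by
  have hw : IsWeakGradient Ω p.fst p.snd := hp
  exact (hw.comp hΩ (Lp.stronglyMeasurable p.snd)
    (integrableOn_of_L2 p.fst) (integrableOn_of_L2 p.snd) hG.contDiff hG.bound hG.bound_deriv
    ((integrableOn_of_L2 q.fst).congr h.1) ((integrableOn_of_L2 q.snd).congr h.2)).congr_ae h.1 h.2

theorem tendsto_zero_L2_of_dominated {α H : Type*} [MeasurableSpace α] {μ : Measure α}
    [NormedAddCommGroup H] [InnerProductSpace ℝ H] {X : ℕ → Lp H 2 μ} {c : ℕ → α → ℝ}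
    {g : Lp H 2 μ} {C : ℝ} (hX : ∀ n, X n =ᵐ[μ] fun x => c n x • g x) (hC : ∀ n x, |c n x| ≤ C)
    (hc : ∀ᵐ x ∂μ, Tendsto (fun n => c n x) atTop (𝓝 0)) : Tendsto X atTop (𝓝 0) := by
  have h1 : ∀ n, ‖X n‖ ^ 2 = ∫ x, ‖X n x‖ ^ 2 ∂μ := by
    intro n
    rw [← real_inner_self_eq_norm_sq, L2.inner_def]
    simp_rw [real_inner_self_eq_norm_sq]
  have hg : Integrable (fun x => ‖g x‖ ^ 2) μ := (Lp.memLp g).integrable_norm_pow (by simp)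
  have h2 : Tendsto (fun n => ∫ x, ‖X n x‖ ^ 2 ∂μ) atTop (𝓝 (∫ _, (0 : ℝ) ∂μ)) := by
    refine tendsto_integral_of_dominated_convergence (fun x => C ^ 2 * ‖g x‖ ^ 2) ?_
      (hg.const_mul _) ?_ ?_
    · exact fun n => ((Lp.memLp (X n)).aestronglyMeasurable.norm.pow 2)
    · intro n
      filter_upwards [hX n] with x hx
      rw [hx, norm_smul, mul_pow, Real.norm_of_nonneg (by positivity), Real.norm_eq_abs]
      gcongr
      exact hC n x
    · filter_upwards [hc, ae_all_iff.2 hX] with x hx hx2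
      simp_rw [hx2, norm_smul]
      have := ((hx.norm).mul_const ‖g x‖).pow 2
      simpa using this
  rw [tendsto_zero_iff_norm_tendsto_zero]
  have h3 : Tendsto (fun n => √(‖X n‖ ^ 2)) atTop (𝓝 0) := by
    simp_rw [h1]
    have := (Real.continuous_sqrt.tendsto _).comp h2
    simpa [Function.comp_def] using this
  simpa [Real.sqrt_sq] using h3

/-- The function part follows from the Lipschitz bound on `G`. The gradient error splits into
`G'(pₙ) (∇pₙ - ∇p)`, controlled by the bound on `G'`, and `(G'(pₙ) - G'(p)) ∇p`, which needs
dominated convergence and hence the almost everywhere hypothesis. -/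
theorem IsComp.tendsto {G : ℝ → ℝ} {C : ℝ} (hG : IsSmoothCutoff G C) {p : ℕ → L2Pair Ω}
    {q : ℕ → L2Pair Ω} {p' q' : L2Pair Ω} (hp : Tendsto p atTop (𝓝 p'))
    (hae : ∀ᵐ x ∂(volume.restrict Ω), Tendsto (fun n => (p n).fst x) atTop (𝓝 (p'.fst x)))
    (h : ∀ n, IsComp G (p n) (q n)) (h' : IsComp G p' q') : Tendsto q atTop (𝓝 q') := by
  have c1 : Continuous fun p : L2Pair Ω => p.fst := WithLp.continuous_fst 2 _ _
  have c2 : Continuous fun p : L2Pair Ω => p.snd := WithLp.continuous_snd 2 _ _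
  have hp1 : Tendsto (fun n => ‖(p n).fst - p'.fst‖) atTop (𝓝 0) :=
    tendsto_iff_norm_sub_tendsto_zero.1 ((c1.tendsto _).comp hp)
  have hp2 : Tendsto (fun n => ‖(p n).snd - p'.snd‖) atTop (𝓝 0) :=
    tendsto_iff_norm_sub_tendsto_zero.1 ((c2.tendsto _).comp hp)
  have hf : Tendsto (fun n => (q n).fst) atTop (𝓝 q'.fst) := by
    rw [tendsto_iff_norm_sub_tendsto_zero]
    refine squeeze_zero (fun _ => norm_nonneg _) (fun n => ?_) (by simpa using hp1.const_mul C)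
    refine Lp.norm_le_mul_norm_of_ae_le_mul ?_
    filter_upwards [(h n).1, h'.1, Lp.coeFn_sub (q n).fst q'.fst,
      Lp.coeFn_sub (p n).fst p'.fst] with x a1 a2 a3 a4
    rw [a3, a4, Pi.sub_apply, Pi.sub_apply, a1, a2]
    exact hG.abs_sub_le _ _
  have hs : Tendsto (fun n => (q n).snd) atTop (𝓝 q'.snd) := by
    have hm : ∀ n, MemLp (fun x => (deriv G ((p n).fst x) - deriv G (p'.fst x)) • p'.snd x) 2
        (volume.restrict Ω) := by
      intro n
      refine MemLp.of_le_mul (c := 2 * C) (Lp.memLp p'.snd)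
        (((hG.continuous_deriv.comp_aestronglyMeasurable
          (Lp.memLp (p n).fst).aestronglyMeasurable).sub
          (hG.continuous_deriv.comp_aestronglyMeasurable
          (Lp.memLp p'.fst).aestronglyMeasurable)).smul
          (Lp.memLp p'.snd).aestronglyMeasurable) (ae_of_all _ fun x => ?_)
      rw [norm_smul]
      gcongr
      calc ‖deriv G ((p n).fst x) - deriv G (p'.fst x)‖ ≤ C + C :=
            (norm_sub_le _ _).trans (add_le_add (hG.bound_deriv _) (hG.bound_deriv _))
        _ = 2 * C := by ring
    have h2 : Tendsto (fun n => (hm n).toLp _) atTop (𝓝 0) := by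
      refine tendsto_zero_L2_of_dominated (C := 2 * C) (fun n => (hm n).coeFn_toLp) ?_ ?_
      · intro n x
        calc |deriv G ((p n).fst x) - deriv G (p'.fst x)| ≤ C + C :=
            (abs_sub _ _).trans (add_le_add (hG.bound_deriv _) (hG.bound_deriv _))
          _ = 2 * C := by ring
      · filter_upwards [hae] with x hx
        have := ((hG.continuous_deriv.tendsto _).comp hx).sub_const (deriv G (p'.fst x))
        simpa using this
    rw [tendsto_iff_norm_sub_tendsto_zero]
    have h3 : Tendsto (fun n => C * ‖(p n).snd - p'.snd‖ + ‖(hm n).toLp _‖) atTop (𝓝 0) := by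
      simpa using (hp2.const_mul C).add h2.norm
    refine squeeze_zero (fun _ => norm_nonneg _) (fun n => ?_) h3
    have h4 : ‖(q n).snd - q'.snd - (hm n).toLp _‖ ≤ C * ‖(p n).snd - p'.snd‖ := by
      refine Lp.norm_le_mul_norm_of_ae_le_mul ?_
      filter_upwards [(h n).2, h'.2, Lp.coeFn_sub ((q n).snd - q'.snd) ((hm n).toLp _),
        Lp.coeFn_sub (q n).snd q'.snd, (hm n).coeFn_toLp,
        Lp.coeFn_sub (p n).snd p'.snd] with x a1 a2 a3 a4 a5 a6
      rw [a3, Pi.sub_apply, a4, a6, Pi.sub_apply, Pi.sub_apply, a1, a2, a5]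
      have : deriv G ((p n).fst x) • (p n).snd x - deriv G (p'.fst x) • p'.snd x
          - (deriv G ((p n).fst x) - deriv G (p'.fst x)) • p'.snd x
          = deriv G ((p n).fst x) • ((p n).snd x - p'.snd x) := by module
      rw [this, norm_smul]
      gcongr
      exact hG.bound_deriv _
    calc ‖(q n).snd - q'.snd‖ = ‖((q n).snd - q'.snd - (hm n).toLp _) + (hm n).toLp _‖ := by
          rw [sub_add_cancel]
      _ ≤ _ := (norm_add_le _ _).trans (add_le_add_left h4 _)
  have := (WithLp.prod_continuous_toLp 2 (L2 Ω) (L2Vec Ω)).tendsto (q'.fst, q'.snd)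
  exact this.comp (hf.prodMk_nhds hs)

theorem gradient_comp {G : ℝ → ℝ} (hG : ContDiff ℝ ∞ G) {ζ : Space d → ℝ}
    (hζ : ContDiff ℝ ∞ ζ) (x : Space d) :
    gradient (fun x => G (ζ x)) x = deriv G (ζ x) • gradient ζ x := by
  have h2 : HasFDerivAt (fun x => G (ζ x)) (deriv G (ζ x) • fderiv ℝ ζ x) x :=
    ((hG.differentiable (by simp)) (ζ x)).hasDerivAt.comp_hasFDerivAt x
      (hζ.differentiable (by simp) x).hasFDerivAt
  refine ext_inner_right ℝ fun e => ?_
  rw [inner_gradient_left, h2.fderiv, real_inner_smul_left, inner_gradient_left]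
  rfl

/-- The core is a vector space, so its span contains only core functions, and for these composition
with `G` is classical. The closure is reached along an approximating sequence, thinned to converge
almost everywhere. -/
theorem IsComp.mem_smoothClosure {core : Set (Space d → ℝ)} (hcore : ∀ ζ ∈ core, ContDiff ℝ ∞ ζ)
    (h0 : (0 : Space d → ℝ) ∈ core) (hadd : ∀ ζ ∈ core, ∀ ξ ∈ core, ζ + ξ ∈ core)
    (hsmul : ∀ (c : ℝ), ∀ ζ ∈ core, c • ζ ∈ core) [IsFiniteMeasure (volume.restrict Ω)]
    {G : ℝ → ℝ} {C : ℝ} (hG : IsSmoothCutoff G C) (hcomp : ∀ ζ ∈ core, (fun x => G (ζ x)) ∈ core)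
    {p q : L2Pair Ω} (hp : p ∈ smoothClosure Ω core) (h : IsComp G p q) :
    q ∈ smoothClosure Ω core := by
  set S : Set (L2Pair Ω) := {p : L2Pair Ω | ∃ ζ ∈ core,
    p.fst =ᵐ[volume.restrict Ω] ζ ∧ p.snd =ᵐ[volume.restrict Ω] gradient ζ} with hS
  have hspan : ∀ p ∈ Submodule.span ℝ S, p ∈ S := by
    intro p hp
    induction hp using Submodule.span_induction with
    | mem p hp => exact hp
    | zero =>
      refine ⟨0, h0, Lp.coeFn_zero ℝ 2 _, ?_⟩
      filter_upwards [Lp.coeFn_zero (Space d) 2 (volume.restrict Ω)] with x hx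
      rw [WithLp.zero_snd, hx]
      exact (gradient_fun_const x (0 : ℝ)).symm
    | add p q _ _ hp hq =>
      obtain ⟨ζ, hζ, a1, a2⟩ := hp
      obtain ⟨ξ, hξ, b1, b2⟩ := hq
      refine ⟨ζ + ξ, hadd ζ hζ ξ hξ, ?_, ?_⟩
      · filter_upwards [a1, b1, Lp.coeFn_add p.fst q.fst] with x h1 h2 h3
        rw [WithLp.add_fst, h3, Pi.add_apply, h1, h2, Pi.add_apply]
      · filter_upwards [a2, b2, Lp.coeFn_add p.snd q.snd] with x h1 h2 h3
        rw [WithLp.add_snd, h3, Pi.add_apply, h1, h2]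
        refine ext_inner_right ℝ fun e => ?_
        rw [inner_add_left, inner_gradient_left, inner_gradient_left, inner_gradient_left,
          fderiv_add ((hcore ζ hζ).differentiable (by simp) x)
            ((hcore ξ hξ).differentiable (by simp) x)]
        rfl
    | smul c p _ hp =>
      obtain ⟨ζ, hζ, a1, a2⟩ := hp
      refine ⟨c • ζ, hsmul c ζ hζ, ?_, ?_⟩
      · filter_upwards [a1, Lp.coeFn_smul c p.fst] with x h1 h3
        rw [WithLp.smul_fst, h3, Pi.smul_apply, h1, Pi.smul_apply]
      · filter_upwards [a2, Lp.coeFn_smul c p.snd] with x h1 h3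
        rw [WithLp.smul_snd, h3, Pi.smul_apply, h1]
        refine ext_inner_right ℝ fun e => ?_
        rw [real_inner_smul_left, inner_gradient_left, inner_gradient_left,
          fderiv_const_smul ((hcore ζ hζ).differentiable (by simp) x)]
        rfl
  have hp' : p ∈ closure (Submodule.span ℝ S : Set (L2Pair Ω)) := hp
  obtain ⟨p₀, hp₀, hlim₀⟩ := mem_closure_iff_seq_limit.1 hp'
  have c1 : Continuous fun p : L2Pair Ω => p.fst := WithLp.continuous_fst 2 _ _
  obtain ⟨ns, hns, hae⟩ :=
    (tendstoInMeasure_of_tendsto_Lp ((c1.tendsto _).comp hlim₀)).exists_seq_tendsto_ae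
  choose q₁ hq₁ using fun n => hG.exists_isComp (p₀ (ns n))
  have hlim := IsComp.tendsto hG (hlim₀.comp hns.tendsto_atTop) hae hq₁ h
  refine mem_closure_of_tendsto hlim (Eventually.of_forall fun n => Submodule.subset_span ?_)
  obtain ⟨ζ, hζ, a1, a2⟩ := hspan _ (hp₀ (ns n))
  refine ⟨fun x => G (ζ x), hcomp ζ hζ, ?_, ?_⟩
  · filter_upwards [(hq₁ n).1, a1] with x b1 b2
    rw [b1, b2]
  · filter_upwards [(hq₁ n).2, a1, a2] with x b1 b2 b3
    rw [b1, b2, b3, gradient_comp hG.contDiff (hcore ζ hζ)]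

/-- The energy space is stable under smooth cutoffs. -/
theorem IsSmoothCutoff.exists_mem_energySpace [IsFiniteMeasure (volume.restrict Ω)]
    (hΩ : IsOpen Ω) {G : ℝ → ℝ} {C : ℝ} (hG : IsSmoothCutoff G C) (u : energySpace Ω bc) :
    ∃ v : energySpace Ω bc, (fn v =ᵐ[volume.restrict Ω] fun x => G (fn u x)) ∧
      grad v =ᵐ[volume.restrict Ω] fun x => deriv G (fn u x) • grad u x := by
  obtain ⟨q, hq⟩ := hG.exists_isComp (u : L2Pair Ω)
  suffices hmem : q ∈ energySpace Ω bc from ⟨⟨q, hmem⟩, hq⟩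
  have hu := u.2
  cases bc with
  | neumann => exact hq.mem_sobolevH1 hΩ hG hu
  | dirichlet =>
    refine hq.mem_smoothClosure (fun ζ hζ => hζ.1) ?_ ?_ ?_ hG ?_ hu
    · refine ⟨contDiff_const, HasCompactSupport.zero, ?_⟩
      simp [tsupport]
    · exact fun ζ hζ ξ hξ => ⟨hζ.1.add hξ.1, hζ.2.1.add hξ.2.1,
        (tsupport_add ζ ξ).trans (union_subset hζ.2.2 hξ.2.2)⟩
    · exact fun c ζ hζ => ⟨hζ.1.const_smul c, hζ.2.1.smul_left (f := fun _ => c),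
        (closure_mono (Function.support_const_smul_subset c ζ)).trans hζ.2.2⟩
    -- The condition `G 0 = 0` keeps the support compact and inside `Ω`.
    · refine fun ζ hζ => ⟨hG.contDiff.comp hζ.1, hζ.2.1.comp_left hG.zero,
        (closure_mono ?_).trans hζ.2.2⟩
      exact Function.support_comp_subset hG.zero ζ
  | periodic a L =>
    refine hq.mem_smoothClosure (fun ζ hζ => hζ.1) ?_ ?_ ?_ hG ?_ hu
    · exact ⟨contDiff_const, fun i x => rfl⟩
    · exact fun ζ hζ ξ hξ => ⟨hζ.1.add hξ.1, fun i x => by simp [hζ.2 i x, hξ.2 i x]⟩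
    · exact fun c ζ hζ => ⟨hζ.1.const_smul c, fun i x => by simp [hζ.2 i x]⟩
    · exact fun ζ hζ => ⟨hG.contDiff.comp hζ.1, fun i x => by simp [hζ.2 i x]⟩

end GradientFlow

/-! ### The semi-implicit step in abstract Hilbert spaces. -/

namespace GradientFlow

section AbstractStep

variable {V H K : Type*} [NormedAddCommGroup V] [InnerProductSpace ℝ V]
  [NormedAddCommGroup H] [InnerProductSpace ℝ H] [NormedAddCommGroup K] [InnerProductSpace ℝ K]

/-- The semi-implicit step `w - u = -η (D* D w + b)` in weak form. -/
def IsStep (ι : V →L[ℝ] H) (D : V →L[ℝ] K) (u : V) (b : H) (η : ℝ) (w : V) : Prop :=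
  ∀ v : V, inner ℝ (ι w - ι u) (ι v) = -η * (inner ℝ (D w) (D v) + inner ℝ b (ι v))

variable {ι : V →L[ℝ] H} {D : V →L[ℝ] K}

/-- The increment solves a step driven by the residual at `w₁`. Energy decay, continuity in `η` and
the lower bound on the speed are all read off from this identity. -/
theorem IsStep.sub {u : V} {b : H} {η₁ η₂ : ℝ} {w₁ w₂ : V} (h₁ : IsStep ι D u b η₁ w₁)
    (h₂ : IsStep ι D u b η₂ w₂) (v : V) :
    inner ℝ (ι (w₂ - w₁)) (ι v) + η₂ * inner ℝ (D (w₂ - w₁)) (D v) =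
      -((η₂ - η₁) * (inner ℝ (D w₁) (D v) + inner ℝ b (ι v))) := by
  have e₁ := h₁ v
  have e₂ := h₂ v
  simp only [map_sub, inner_sub_left] at e₁ e₂ ⊢
  linear_combination e₂ - e₁

theorem IsStep.unique (hinj : ∀ v, ι v = 0 → v = 0) {u : V} {b : H} {η : ℝ} (hη : 0 ≤ η)
    {w₁ w₂ : V} (h₁ : IsStep ι D u b η w₁) (h₂ : IsStep ι D u b η w₂) : w₁ = w₂ := by
  have h := h₁.sub h₂ (w₂ - w₁)
  rw [real_inner_self_eq_norm_sq, real_inner_self_eq_norm_sq, sub_self, zero_mul, neg_zero] at h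
  have h0 : ‖ι (w₂ - w₁)‖ = 0 := by
    nlinarith [norm_nonneg (ι (w₂ - w₁)), mul_nonneg hη (sq_nonneg ‖D (w₂ - w₁)‖)]
  exact (sub_eq_zero.1 (hinj _ (norm_eq_zero.1 h0))).symm

/-- Increasing the multiplier decreases the quadratic part of the energy. -/
theorem IsStep.decrease {u : V} {b : H} {η₁ η₂ : ℝ} (h0 : 0 ≤ η₁) (h12 : η₁ < η₂) {w₁ w₂ : V}
    (h₁ : IsStep ι D u b η₁ w₁) (h₂ : IsStep ι D u b η₂ w₂) :
    1 / 2 * ‖D w₂‖ ^ 2 - 1 / 2 * ‖D w₁‖ ^ 2 + inner ℝ b (ι (w₂ - w₁)) ≤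
      -(‖ι (w₂ - w₁)‖ ^ 2 / (η₂ - η₁)) := by
  have hh : 0 < η₂ - η₁ := sub_pos.2 h12
  have h := h₁.sub h₂ (w₂ - w₁)
  rw [real_inner_self_eq_norm_sq, real_inner_self_eq_norm_sq] at h
  have hD : ‖D w₂‖ ^ 2 = ‖D w₁‖ ^ 2 + 2 * inner ℝ (D w₁) (D (w₂ - w₁)) + ‖D (w₂ - w₁)‖ ^ 2 := by
    rw [← norm_add_sq_real, ← map_add, add_sub_cancel]
  rw [hD, ← neg_div, le_div_iff₀ hh]
  -- The term `½ ‖D (w₂ - w₁)‖²` from expanding the square is absorbed by `η₂ / (η₂ - η₁) ‖D (w₂ -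
  -- w₁)‖²`, as `η₂ - η₁ ≤ η₂`.
  nlinarith [mul_nonneg h0 (sq_nonneg ‖D (w₂ - w₁)‖),
    mul_nonneg hh.le (sq_nonneg ‖D (w₂ - w₁)‖)]

/-- Test with `w - u` and use Young's inequality twice. The displacement is of order `√η`, which is
all that can be had for `u` merely in `V`. -/
theorem IsStep.norm_sub_sq_le {u : V} {b : H} {η : ℝ} (hη : 0 ≤ η) {w : V}
    (h : IsStep ι D u b η w) : ‖ι w - ι u‖ ^ 2 ≤ η * ‖D u‖ ^ 2 + η ^ 2 * ‖b‖ ^ 2 := by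
  have h1 := h (w - u)
  rw [map_sub, real_inner_self_eq_norm_sq] at h1
  have hD : inner ℝ (D w) (D (w - u)) = inner ℝ (D u) (D (w - u)) + ‖D (w - u)‖ ^ 2 := by
    rw [← real_inner_self_eq_norm_sq, ← inner_add_left, ← map_add, add_sub_cancel]
  rw [hD] at h1
  have h2 := (abs_le.1 (abs_real_inner_le_norm (D u) (D (w - u)))).1
  have h3 := (abs_le.1 (abs_real_inner_le_norm b (ι w - ι u))).1
  set X := ‖ι w - ι u‖
  set Y := ‖D (w - u)‖
  have h4 := mul_le_mul_of_nonneg_left h2 hη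
  have h5 := mul_le_mul_of_nonneg_left h3 hη
  nlinarith [mul_nonneg hη (sq_nonneg (2 * Y - ‖D u‖)), sq_nonneg (X - η * ‖b‖),
    mul_nonneg hη (sq_nonneg ‖D u‖)]

variable [CompleteSpace V] [CompleteSpace H]

theorem eq_zero_of_inner_adjoint_eq_zero (hinj : ∀ v, ι v = 0 → v = 0) {v : V}
    (h : ∀ g : H, inner ℝ (ContinuousLinearMap.adjoint ι g) v = (0 : ℝ)) : v = 0 := by
  refine hinj v ?_
  have := h (ι v)
  rwa [ContinuousLinearMap.adjoint_inner_left, inner_self_eq_zero] at this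

/-- Injectivity of `ι` makes the orthogonal complement of the adjoint's range trivial. The vectors
`ι* g` play the role of regular test functions, the weak solutions of `-Δv + v = g`: pairing with
them in `V` involves only the norm of `H`. -/
theorem exists_norm_sub_adjoint_lt (hinj : ∀ v, ι v = 0 → v = 0) (v : V) {ε : ℝ} (hε : 0 < ε) :
    ∃ g : H, ‖v - ContinuousLinearMap.adjoint ι g‖ < ε := by
  have htop : (ContinuousLinearMap.adjoint ι).range.topologicalClosure = ⊤ := by
    rw [Submodule.topologicalClosure_eq_top_iff, Submodule.eq_bot_iff]
    intro v hv
    refine eq_zero_of_inner_adjoint_eq_zero hinj fun g => ?_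
    exact (Submodule.mem_orthogonal _ v).1 hv _ ⟨g, rfl⟩
  have hv : v ∈ closure ((ContinuousLinearMap.adjoint ι).range : Set V) := by
    rw [← Submodule.topologicalClosure_coe, htop]
    trivial
  obtain ⟨_, ⟨g, rfl⟩, hg⟩ := Metric.mem_closure_iff.1 hv ε hε
  exact ⟨g, by rwa [dist_eq_norm] at hg⟩

/-- A bounded family of `V` that tends to zero in `H` tends to zero weakly in `V`. -/
theorem tendsto_inner_of_tendsto_map (hinj : ∀ v, ι v = 0 → v = 0) {α : Type*} {l : Filter α}
    {δ : α → V} {C : ℝ} (hC : ∀ᶠ a in l, ‖δ a‖ ≤ C) (hδ : Tendsto (fun a => ι (δ a)) l (𝓝 0))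
    (z : V) : Tendsto (fun a => inner ℝ z (δ a)) l (𝓝 (0 : ℝ)) := by
  rw [Metric.tendsto_nhds]
  intro ε hε
  have hC' : 0 < |C| + 1 := by positivity
  obtain ⟨g, hg⟩ := exists_norm_sub_adjoint_lt hinj z (ε := ε / 2 / (|C| + 1)) (by positivity)
  have h1 : Tendsto (fun a => inner ℝ g (ι (δ a))) l (𝓝 (0 : ℝ)) := by
    simpa using (tendsto_const_nhds (x := g)).inner hδ
  filter_upwards [hC, (Metric.tendsto_nhds.1 h1) (ε / 2) (by positivity)] with a ha hb
  rw [dist_zero_right, Real.norm_eq_abs] at hb ⊢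
  have h2 : inner ℝ z (δ a) = inner ℝ (z - ContinuousLinearMap.adjoint ι g) (δ a)
      + inner ℝ g (ι (δ a)) := by
    rw [inner_sub_left, ContinuousLinearMap.adjoint_inner_left]
    ring
  have h3 : |inner ℝ (z - ContinuousLinearMap.adjoint ι g) (δ a)| ≤ ε / 2 := by
    refine (abs_real_inner_le_norm _ _).trans ?_
    calc ‖z - ContinuousLinearMap.adjoint ι g‖ * ‖δ a‖
        ≤ (ε / 2 / (|C| + 1)) * (|C| + 1) := by
          gcongr
          exact ha.trans ((le_abs_self C).trans (by linarith))
      _ = ε / 2 := by field_simp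
  rw [h2]
  exact (abs_add_le _ _).trans_lt (by linarith)

theorem exists_isStep
    (hV : ∀ v w : V, inner ℝ v w = inner ℝ (ι v) (ι w) + inner ℝ (D v) (D w))
    (u : V) (b : H) {η : ℝ} (hη : 0 ≤ η) : ∃ w, IsStep ι D u b η w := by
  rcases hη.eq_or_lt with rfl | hpos
  · exact ⟨u, fun v => by simp⟩
  -- By `hV`, this operator represents the form `⟨ι w, ι v⟩ + η ⟨D w, D v⟩`, coercive with constant
  -- `min 1 η`; Lax–Milgram then gives the step.
  let A : V →L[ℝ] V := η • ContinuousLinearMap.id ℝ V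
    + (1 - η) • (ContinuousLinearMap.adjoint ι).comp ι
  let B : V →L[ℝ] V →L[ℝ] ℝ :=
    (isBoundedBilinearMap_inner (𝕜 := ℝ) (E := V)).toContinuousLinearMap.comp A
  have hB : ∀ w v, B w v = inner ℝ (ι w) (ι v) + η * inner ℝ (D w) (D v) := by
    intro w v
    change inner ℝ (A w) v = _
    simp only [A, _root_.add_apply, _root_.smul_apply, ContinuousLinearMap.id_apply,
      ContinuousLinearMap.comp_apply, inner_add_left, real_inner_smul_left,
      ContinuousLinearMap.adjoint_inner_left, hV w v]
    ring
  have hc : IsCoercive B := by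
    refine ⟨min 1 η, lt_min one_pos hpos, fun w => ?_⟩
    have hn : ‖w‖ * ‖w‖ = ‖ι w‖ ^ 2 + ‖D w‖ ^ 2 := by
      rw [← real_inner_self_eq_norm_mul_norm, hV, real_inner_self_eq_norm_sq,
        real_inner_self_eq_norm_sq]
    rw [hB, mul_assoc, hn, real_inner_self_eq_norm_sq, real_inner_self_eq_norm_sq, mul_add]
    have h1 := mul_le_mul_of_nonneg_right (min_le_left 1 η) (sq_nonneg ‖ι w‖)
    have h2 := mul_le_mul_of_nonneg_right (min_le_right 1 η) (sq_nonneg ‖D w‖)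
    linarith
  let w := hc.continuousLinearEquivOfBilin.symm (ContinuousLinearMap.adjoint ι (ι u - η • b))
  refine ⟨w, fun v => ?_⟩
  have h1 := hc.continuousLinearEquivOfBilin_apply w v
  rw [ContinuousLinearEquiv.apply_symm_apply, ContinuousLinearMap.adjoint_inner_left, hB,
    inner_sub_left, real_inner_smul_left] at h1
  rw [inner_sub_left]
  linear_combination -h1

theorem functional_eq_inner
    (hV : ∀ v w : V, inner ℝ v w = inner ℝ (ι v) (ι w) + inner ℝ (D v) (D w))
    (w : V) (b : H) (v : V) :
    inner ℝ (D w) (D v) + inner ℝ b (ι v)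
      = inner ℝ (w + ContinuousLinearMap.adjoint ι (b - ι w)) v := by
  rw [inner_add_left, ContinuousLinearMap.adjoint_inner_left, hV, inner_sub_left]
  ring

/-- Testing the increment `δ` with itself gives `‖ι δ‖² + η ‖D δ‖² ≤ |η - η₀| |⟨z, δ⟩|`, where `z`
represents the residual at `η₀`. Near `η₀` one has `|η - η₀| ≤ η`, even for `η₀ = 0`, so dividing by
`η` yields `‖δ‖² ≤ 2 |⟨z, δ⟩|`. Thus `δ` is bounded in `V` and null in `H`, hence weakly null in
`V`, and the same inequality makes it strongly null. -/
theorem continuousOn_step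
    (hV : ∀ v w : V, inner ℝ v w = inner ℝ (ι v) (ι w) + inner ℝ (D v) (D w))
    (hinj : ∀ v, ι v = 0 → v = 0) {u : V} {b : H} {W : ℝ → V}
    (hW : ∀ η, 0 ≤ η → IsStep ι D u b η (W η)) : ContinuousOn W (Ici 0) := by
  intro η₀ h₀
  have h₀' : 0 ≤ η₀ := h₀
  set z := W η₀ + ContinuousLinearMap.adjoint ι (b - ι (W η₀)) with hz
  have hnear : ∀ᶠ η in 𝓝[Ici 0] η₀, |η - η₀| ≤ η ∧ |η - η₀| ≤ 1 := by
    have hm : ∀ᶠ η in 𝓝[Ici 0] η₀, η ∈ Ici (0 : ℝ) := self_mem_nhdsWithin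
    have h1 : ∀ᶠ η in 𝓝[Ici 0] η₀, |η - η₀| < 1 :=
      mem_nhdsWithin_of_mem_nhds (Metric.ball_mem_nhds η₀ one_pos)
    rcases h₀'.eq_or_lt with h | h
    · filter_upwards [hm, h1] with η hη h1
      rw [← h, sub_zero] at h1 ⊢
      exact ⟨(abs_of_nonneg hη).le, h1.le⟩
    · have h2 : ∀ᶠ η in 𝓝[Ici 0] η₀, |η - η₀| < η₀ / 2 :=
        mem_nhdsWithin_of_mem_nhds (Metric.ball_mem_nhds η₀ (half_pos h))
      filter_upwards [h1, h2] with η h1 h2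
      exact ⟨by linarith [(abs_lt.1 h2).1], h1.le⟩
  have hn : ∀ v : V, ‖v‖ ^ 2 = ‖ι v‖ ^ 2 + ‖D v‖ ^ 2 := fun v => by
    rw [← real_inner_self_eq_norm_sq, hV, real_inner_self_eq_norm_sq, real_inner_self_eq_norm_sq]
  have hest : ∀ᶠ η in 𝓝[Ici 0] η₀, ‖ι (W η - W η₀)‖ ^ 2 ≤ |η - η₀| * |inner ℝ z (W η - W η₀)| ∧
      ‖W η - W η₀‖ ^ 2 ≤ 2 * |inner ℝ z (W η - W η₀)| := by
    filter_upwards [self_mem_nhdsWithin, hnear] with η hη hh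
    have hη' : 0 ≤ η := hη
    have h1 := (hW η₀ h₀').sub (hW η hη') (W η - W η₀)
    rw [functional_eq_inner hV, ← hz, real_inner_self_eq_norm_sq, real_inner_self_eq_norm_sq] at h1
    have h2 : ‖ι (W η - W η₀)‖ ^ 2 + η * ‖D (W η - W η₀)‖ ^ 2
        ≤ |η - η₀| * |inner ℝ z (W η - W η₀)| := by
      rw [h1, ← abs_mul]
      exact neg_le_abs _
    have hX : ‖ι (W η - W η₀)‖ ^ 2 ≤ |η - η₀| * |inner ℝ z (W η - W η₀)| := by
      nlinarith [mul_nonneg hη' (sq_nonneg ‖D (W η - W η₀)‖)]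
    refine ⟨hX, ?_⟩
    rw [hn]
    rcases hη'.eq_or_lt with h | h
    · have : η = η₀ := by
        have := abs_nonpos_iff.1 (hh.1.trans h.symm.le)
        linarith
      simp [this]
    · have h3 : ‖D (W η - W η₀)‖ ^ 2 ≤ |inner ℝ z (W η - W η₀)| := by
        refine le_of_mul_le_mul_left ?_ h
        nlinarith [sq_nonneg ‖ι (W η - W η₀)‖,
          mul_le_mul_of_nonneg_right hh.1 (abs_nonneg (inner ℝ z (W η - W η₀)))]
      nlinarith [mul_le_mul_of_nonneg_right hh.2 (abs_nonneg (inner ℝ z (W η - W η₀)))]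
  have hbd : ∀ᶠ η in 𝓝[Ici 0] η₀, ‖W η - W η₀‖ ≤ 2 * ‖z‖ := by
    filter_upwards [hest] with η hη
    have h1 := abs_real_inner_le_norm z (W η - W η₀)
    by_contra hcon
    push Not at hcon
    nlinarith [norm_nonneg z, norm_nonneg (W η - W η₀), hη.2]
  have hι : Tendsto (fun η => ι (W η - W η₀)) (𝓝[Ici 0] η₀) (𝓝 0) := by
    have habs : Tendsto (fun η => |η - η₀| * (‖z‖ * (2 * ‖z‖))) (𝓝[Ici 0] η₀) (𝓝 0) := by
      have : Tendsto (fun η => |η - η₀| * (‖z‖ * (2 * ‖z‖))) (𝓝 η₀)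
          (𝓝 (|η₀ - η₀| * (‖z‖ * (2 * ‖z‖)))) := Continuous.tendsto (by fun_prop) _
      rw [sub_self, abs_zero, zero_mul] at this
      exact this.mono_left nhdsWithin_le_nhds
    have hsq : Tendsto (fun η => ‖ι (W η - W η₀)‖ ^ 2) (𝓝[Ici 0] η₀) (𝓝 0) := by
      refine squeeze_zero' (Eventually.of_forall fun _ => sq_nonneg _) ?_ habs
      filter_upwards [hest, hbd] with η h1 h2
      refine h1.1.trans (mul_le_mul_of_nonneg_left ?_ (abs_nonneg _))
      exact (abs_real_inner_le_norm _ _).trans (mul_le_mul_of_nonneg_left h2 (norm_nonneg _))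
    rw [tendsto_zero_iff_norm_tendsto_zero]
    have := (Real.continuous_sqrt.tendsto _).comp hsq
    simpa [Function.comp_def] using this
  have hw := tendsto_inner_of_tendsto_map hinj hbd hι z
  have hfin : Tendsto (fun η => ‖W η - W η₀‖ ^ 2) (𝓝[Ici 0] η₀) (𝓝 0) := by
    refine squeeze_zero' (Eventually.of_forall fun _ => sq_nonneg _) (hest.mono fun η h => h.2) ?_
    simpa using hw.abs.const_mul 2
  change Tendsto W _ _
  rw [tendsto_iff_norm_sub_tendsto_zero]
  have := (Real.continuous_sqrt.tendsto _).comp hfin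
  simpa [Function.comp_def] using this

/-- If the residual at `φ` does not vanish, the step moves at a speed bounded from below. -/
theorem exists_le_norm_sub_of_functional_ne_zero
    (hV : ∀ v w : V, inner ℝ v w = inner ℝ (ι v) (ι w) + inner ℝ (D v) (D w))
    (hinj : ∀ v, ι v = 0 → v = 0) {φ : V} {b₀ : H}
    (hne : ∃ v, inner ℝ (D φ) (D v) + inner ℝ b₀ (ι v) ≠ (0 : ℝ)) :
    ∃ c > 0, ∃ ρ > 0, ∀ (u : V) (b : H) (η₁ η₂ : ℝ) (w₁ w₂ : V), 0 ≤ η₁ → η₁ < η₂ → η₂ ≤ ρ →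
      ‖ι w₁ - ι φ‖ ≤ ρ → ‖b - b₀‖ ≤ ρ → IsStep ι D u b η₁ w₁ → IsStep ι D u b η₂ w₂ →
      c * (η₂ - η₁) ≤ ‖ι (w₂ - w₁)‖ := by
  obtain ⟨v₀, hv₀⟩ := hne
  rw [functional_eq_inner hV] at hv₀
  -- By density, a nonzero residual is already detected by some test vector `v = ι* g`. For it `⟨D
  -- z, D v⟩ = ⟨ι z, g - ι v⟩`, so the residual varies continuously in the norm of `H` alone.
  obtain ⟨g, hg⟩ : ∃ g, inner ℝ (ContinuousLinearMap.adjoint ι g)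
      (φ + ContinuousLinearMap.adjoint ι (b₀ - ι φ)) ≠ (0 : ℝ) := by
    by_contra! hcon
    rw [eq_zero_of_inner_adjoint_eq_zero hinj hcon, inner_zero_left] at hv₀
    exact hv₀ rfl
  set v := ContinuousLinearMap.adjoint ι g with hv
  rw [real_inner_comm, ← functional_eq_inner hV] at hg
  have hDv : ∀ z : V, inner ℝ (D z) (D v) = inner ℝ (ι z) (g - ι v) := fun z => by
    have h1 := hV z v
    rw [hv, ContinuousLinearMap.adjoint_inner_right, ← hv] at h1
    rw [inner_sub_right]
    linarith
  rw [hDv] at hg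
  set a := |inner ℝ (ι φ) (g - ι v) + inner ℝ b₀ (ι v)| with ha
  have hapos : 0 < a := abs_pos.2 hg
  set B := ‖g - ι v‖ + ‖ι v‖ with hB
  have hB0 : 0 ≤ B := by positivity
  -- The radius keeps the residual tested with `v` above `a / 2` and ensures `η₂ ≤ 1`, so that `‖ι
  -- (w₂ - w₁)‖ * B` bounds the left side. `B + 1` keeps the denominators positive.
  refine ⟨a / (4 * (B + 1)), by positivity, min 1 (a / (2 * (B + 1))), by positivity, ?_⟩
  intro u b η₁ η₂ w₁ w₂ h0 h12 hρ hw hb h₁ h₂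
  set ρ := min 1 (a / (2 * (B + 1))) with hρdef
  have hρ1 : ρ ≤ 1 := min_le_left _ _
  have hρ2 : ρ * (B + 1) ≤ a / 2 := by
    calc ρ * (B + 1) ≤ a / (2 * (B + 1)) * (B + 1) := by gcongr; exact min_le_right _ _
      _ = a / 2 := by field_simp
  have hρ0 : 0 < ρ := by positivity
  have e := h₁.sub h₂ v
  rw [hDv, hDv] at e
  have hh : 0 < η₂ - η₁ := sub_pos.2 h12
  -- the functional at `w₁` is close to the one at `φ`
  have h1 : a - ρ * B ≤ |inner ℝ (ι w₁) (g - ι v) + inner ℝ b (ι v)| := by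
    have h2 : inner ℝ (ι φ) (g - ι v) + inner ℝ b₀ (ι v)
        = (inner ℝ (ι w₁) (g - ι v) + inner ℝ b (ι v))
          - (inner ℝ (ι w₁ - ι φ) (g - ι v) + inner ℝ (b - b₀) (ι v)) := by
      simp only [inner_sub_left]
      ring
    have h3 : |inner ℝ (ι w₁ - ι φ) (g - ι v) + inner ℝ (b - b₀) (ι v)| ≤ ρ * B := by
      refine (abs_add_le _ _).trans ?_
      rw [hB, mul_add]
      refine add_le_add ((abs_real_inner_le_norm _ _).trans ?_)
        ((abs_real_inner_le_norm _ _).trans ?_) <;> gcongr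
    have h4 := abs_sub (inner ℝ (ι w₁) (g - ι v) + inner ℝ b (ι v))
      (inner ℝ (ι w₁ - ι φ) (g - ι v) + inner ℝ (b - b₀) (ι v))
    rw [← h2, ← ha] at h4
    linarith
  have h5 : |inner ℝ (ι (w₂ - w₁)) (ι v) + η₂ * inner ℝ (ι (w₂ - w₁)) (g - ι v)|
      ≤ ‖ι (w₂ - w₁)‖ * B := by
    refine (abs_add_le _ _).trans ?_
    have h6 := abs_real_inner_le_norm (ι (w₂ - w₁)) (ι v)
    have h7 := abs_real_inner_le_norm (ι (w₂ - w₁)) (g - ι v)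
    rw [abs_mul, abs_of_nonneg (by linarith : 0 ≤ η₂), hB, mul_add]
    have h8 : η₂ * |inner ℝ (ι (w₂ - w₁)) (g - ι v)| ≤ 1 * (‖ι (w₂ - w₁)‖ * ‖g - ι v‖) := by
      gcongr
      exact hρ.trans hρ1
    linarith
  rw [e, abs_neg, abs_mul, abs_of_pos hh] at h5
  have h9 : (η₂ - η₁) * (a / 2) ≤ ‖ι (w₂ - w₁)‖ * (B + 1) := by
    have h10 : (η₂ - η₁) * (a / 2) ≤ (η₂ - η₁) *
        |inner ℝ (ι w₁) (g - ι v) + inner ℝ b (ι v)| := by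
      gcongr
      nlinarith
    nlinarith [norm_nonneg (ι (w₂ - w₁))]
  rw [div_mul_eq_mul_div, div_le_iff₀ (by positivity)]
  nlinarith [norm_nonneg (ι (w₂ - w₁))]

end AbstractStep

end GradientFlow

/-! ### Truncations, moduli of continuity, Taylor remainder and maximum principle. -/

namespace GradientFlow

/-- A monotone smooth cutoff which vanishes exactly on `[-R, R]`. -/
theorem exists_isSmoothCutoff (R : ℝ) (hR : 0 ≤ R) : ∃ (G : ℝ → ℝ) (C : ℝ), IsSmoothCutoff G C ∧
    (∀ s, 0 ≤ deriv G s) ∧ (∀ s, R < s → 0 < G s) ∧ (∀ s, s < -R → G s < 0) ∧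
      ∀ s, |s| ≤ R → G s = 0 := by
  have hT : ContDiff ℝ ∞ Real.smoothTransition := Real.smoothTransition.contDiff
  have hTc : HasCompactSupport (deriv Real.smoothTransition) := by
    refine HasCompactSupport.intro (isCompact_Icc (a := (0 : ℝ)) (b := 1)) fun x hx => ?_
    rw [mem_Icc, not_and_or, not_le, not_le] at hx
    rcases hx with hx | hx
    · have : Real.smoothTransition =ᶠ[𝓝 x] fun _ => 0 := by
        filter_upwards [gt_mem_nhds hx] with y hy using Real.smoothTransition.zero_of_nonpos hy.le
      rw [this.deriv_eq, deriv_const]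
    · have : Real.smoothTransition =ᶠ[𝓝 x] fun _ => 1 := by
        filter_upwards [lt_mem_nhds hx] with y hy using Real.smoothTransition.one_of_one_le hy.le
      rw [this.deriv_eq, deriv_const]
  obtain ⟨B, hB⟩ := hTc.exists_bound_of_continuous (hT.continuous_deriv (by simp))
  have hT0 : ∀ x, 0 ≤ deriv Real.smoothTransition x := fun x =>
    Real.smoothTransition.monotone.deriv_nonneg
  have hd : ∀ s, HasDerivAt
      (fun s => Real.smoothTransition (s - R) - Real.smoothTransition (-s - R))
      (deriv Real.smoothTransition (s - R) + deriv Real.smoothTransition (-s - R)) s := by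
    intro s
    have h1 : HasDerivAt (fun s => Real.smoothTransition (s - R))
        (deriv Real.smoothTransition (s - R)) s :=
      ((hT.differentiable (by simp)) (s - R)).hasDerivAt.comp_sub_const s R
    have h2 : HasDerivAt (Real.smoothTransition ∘ fun s => -s - R)
        (deriv Real.smoothTransition (-s - R) * (-1)) s :=
      HasDerivAt.comp s ((hT.differentiable (by simp)) (-s - R)).hasDerivAt
        ((hasDerivAt_neg s).sub_const R)
    exact (h1.sub h2).congr_deriv (by ring)
  refine ⟨fun s => Real.smoothTransition (s - R) - Real.smoothTransition (-s - R), max 1 (B + B),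
    ⟨(hT.comp (by fun_prop)).sub (hT.comp (by fun_prop)), by simp, fun s => ?_, fun s => ?_⟩,
    fun s => ?_, fun s hs => ?_, fun s hs => ?_, fun s hs => ?_⟩
  · refine le_max_of_le_left (abs_le.2 ⟨?_, ?_⟩)
    · linarith [Real.smoothTransition.nonneg (s - R), Real.smoothTransition.le_one (-s - R)]
    · linarith [Real.smoothTransition.nonneg (-s - R), Real.smoothTransition.le_one (s - R)]
  · rw [(hd s).deriv]
    exact le_max_of_le_right ((abs_add_le _ _).trans (add_le_add (hB _) (hB _)))
  · rw [(hd s).deriv]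
    exact add_nonneg (hT0 _) (hT0 _)
  · have h1 := Real.smoothTransition.pos_of_pos (sub_pos.2 hs)
    have h2 := Real.smoothTransition.zero_of_nonpos (x := -s - R) (by linarith)
    simp only [h2, sub_zero, h1]
  · have h1 := Real.smoothTransition.pos_of_pos (x := -s - R) (by linarith)
    have h2 := Real.smoothTransition.zero_of_nonpos (x := s - R) (by linarith)
    simp only [h2, zero_sub, neg_lt_zero, h1]
  · obtain ⟨h3, h4⟩ := abs_le.1 hs
    have h1 := Real.smoothTransition.zero_of_nonpos (x := -s - R) (by linarith)
    have h2 := Real.smoothTransition.zero_of_nonpos (x := s - R) (by linarith)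
    simp only [h1, h2, sub_zero]

/-- Linear modulus of continuity up to a small constant. -/
theorem exists_abs_sub_le_add_mul {f : ℝ → ℝ} (hf : Continuous f) (R : ℝ) {σ : ℝ} (hσ : 0 < σ) :
    ∃ K ≥ 0, ∀ a b, |a| ≤ R → |b| ≤ R → |f a - f b| ≤ σ + K * |a - b| := by
  have hcomp : IsCompact (Icc (-R) R) := isCompact_Icc
  obtain ⟨B, hB⟩ := hcomp.exists_bound_of_continuousOn hf.continuousOn
  obtain ⟨r, hr, hunif⟩ := Metric.uniformContinuousOn_iff.1
    (hcomp.uniformContinuousOn_of_continuous hf.continuousOn) σ hσ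
  -- Points closer than `r` are handled by `σ`; for the others the oscillation `2 |B|` is at most
  -- this slope times the distance.
  refine ⟨2 * |B| / r, by positivity, fun a b ha hb => ?_⟩
  have ha' : a ∈ Icc (-R) R := abs_le.1 ha
  have hb' : b ∈ Icc (-R) R := abs_le.1 hb
  by_cases hab : |a - b| < r
  · have h1 : |f a - f b| < σ := hunif a ha' b hb' hab
    have : 0 ≤ 2 * |B| / r * |a - b| := by positivity
    linarith
  · push Not at hab
    have h1 : |f a - f b| ≤ 2 * |B| := by
      have h2 : |f a| ≤ B := hB a ha'
      have h3 : |f b| ≤ B := hB b hb'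
      linarith [abs_sub (f a) (f b), le_abs_self B]
    have h2 : 2 * |B| ≤ 2 * |B| / r * |a - b| := by
      rw [div_mul_eq_mul_div, le_div_iff₀ hr]
      gcongr
    linarith

/-- Mean value inequality for `F z - f c * z` between `a` and `b`. The base point `c` differs from
both ends because the scheme freezes `f` at the predictor while comparing two correctors. -/
theorem abs_taylor_le {F f : ℝ → ℝ} (hF : ∀ z, HasDerivAt F (f z) z) {R σ K : ℝ} (hK : 0 ≤ K)
    (hmod : ∀ a b, |a| ≤ R → |b| ≤ R → |f a - f b| ≤ σ + K * |a - b|) {a b c : ℝ}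
    (ha : |a| ≤ R) (hb : |b| ≤ R) (hc : |c| ≤ R) :
    |F b - F a - f c * (b - a)| ≤ (σ + K * (|a - c| + |b - c|)) * |b - a| := by
  have hd : ∀ z ∈ uIcc a b, HasDerivWithinAt (fun z => F z - f c * z) (f z - f c) (uIcc a b) z :=
    fun z _ =>
      (((hF z).sub ((hasDerivAt_id z).const_mul (f c))).congr_deriv (by simp)).hasDerivWithinAt
  have hbound : ∀ z ∈ uIcc a b, ‖f z - f c‖ ≤ σ + K * (|a - c| + |b - c|) := by
    intro z hz
    have hzR : |z| ≤ R := by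
      have h1 : z ∈ Icc (-R) R := uIcc_subset_Icc (abs_le.1 ha) (abs_le.1 hb) hz
      exact abs_le.2 h1
    have hzc : |z - c| ≤ |a - c| + |b - c| := by
      rcases mem_uIcc.1 hz with ⟨h1, h2⟩ | ⟨h1, h2⟩ <;>
      · refine abs_le.2 ⟨?_, ?_⟩ <;>
        linarith [neg_abs_le (a - c), neg_abs_le (b - c), le_abs_self (a - c), le_abs_self (b - c),
          abs_nonneg (a - c), abs_nonneg (b - c)]
    refine (hmod z c hzR hc).trans ?_
    gcongr
  have := (convex_uIcc a b).norm_image_sub_le_of_norm_hasDerivWithin_le hd hbound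
    left_mem_uIcc right_mem_uIcc
  rw [Real.norm_eq_abs, Real.norm_eq_abs] at this
  convert this using 2
  ring

variable {d : ℕ} {Ω : Set (Space d)} {bc : BoundaryCondition d}

/-- The embedding of the energy space into `L²`. -/
noncomputable def fnL : energySpace Ω bc →L[ℝ] L2 Ω :=
  (WithLp.fstL 2 ℝ (L2 Ω) (L2Vec Ω)).comp (energySpace Ω bc).subtypeL

/-- The gradient as a continuous linear map. -/
noncomputable def gradL : energySpace Ω bc →L[ℝ] L2Vec Ω :=
  (WithLp.sndL 2 ℝ (L2 Ω) (L2Vec Ω)).comp (energySpace Ω bc).subtypeL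

theorem fnL_apply (u : energySpace Ω bc) : fnL u = fn u := rfl

theorem gradL_apply (u : energySpace Ω bc) : gradL u = grad u := rfl

theorem inner_energySpace (v w : energySpace Ω bc) :
    inner ℝ v w = inner ℝ (fnL v) (fnL w) + inner ℝ (gradL v) (gradL w) :=
  WithLp.prod_inner_apply (𝕜 := ℝ) (v : L2Pair Ω) (w : L2Pair Ω)

theorem integral_mul_eq_inner {α : Type*} [MeasurableSpace α] {μ : Measure α} {p : α → ℝ}
    {P : Lp ℝ 2 μ} (hP : P =ᵐ[μ] p) (q : Lp ℝ 2 μ) : ∫ x, p x * q x ∂μ = inner ℝ P q := by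
  rw [L2.inner_def]
  refine integral_congr_ae ?_
  filter_upwards [hP] with x hx
  rw [hx]
  simp [mul_comm]

theorem isStep_iff {f : ℝ → ℝ} {u w : energySpace Ω bc} {b : L2 Ω} {η : ℝ}
    (hb : b =ᵐ[volume.restrict Ω] fun x => f (fn u x)) :
    IsStep fnL gradL u b η w ↔ ∀ v : energySpace Ω bc,
      ∫ x in Ω, (fn w x - fn u x) * fn v x =
        -η * (inner ℝ (grad w) (grad v) + ∫ x in Ω, f (fn u x) * fn v x) := by
  have h1 : (fn w - fn u : L2 Ω) =ᵐ[volume.restrict Ω] fun x => fn w x - fn u x :=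
    Lp.coeFn_sub (fn w) (fn u)
  have e1 : ∀ v : energySpace Ω bc, ∫ x in Ω, (fn w x - fn u x) * fn v x
      = inner ℝ (fn w - fn u) (fn v) := fun v => integral_mul_eq_inner h1 (fn v)
  have e2 : ∀ v : energySpace Ω bc, ∫ x in Ω, f (fn u x) * fn v x = inner ℝ b (fn v) :=
    fun v => integral_mul_eq_inner hb (fn v)
  simp only [e1, e2]
  simp only [IsStep, fnL_apply, gradL_apply]

theorem BoundedBy.mono {M M' : ℝ} {u : energySpace Ω bc} (h : BoundedBy M u) (hM : M ≤ M') :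
    BoundedBy M' u :=
  Filter.Eventually.mono h fun _ hx => hx.trans hM

theorem BoundedBy.memLp_comp [IsFiniteMeasure (volume.restrict Ω)] {M : ℝ} {u : energySpace Ω bc}
    (h : BoundedBy M u) {f : ℝ → ℝ} (hf : Continuous f) {p : ENNReal} :
    MemLp (fun x => f (fn u x)) p (volume.restrict Ω) := by
  obtain ⟨B, hB⟩ := (isCompact_Icc (a := -M) (b := M)).exists_bound_of_continuousOn hf.continuousOn
  refine MemLp.of_bound (hf.comp_aestronglyMeasurable (Lp.memLp (fn u)).aestronglyMeasurable) B ?_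
  filter_upwards [h] with x hx using hB _ (abs_le.1 hx)

/-- Maximum principle for the step. -/
theorem IsStep.boundedBy [IsFiniteMeasure (volume.restrict Ω)] (hΩ : IsOpen Ω) {M B : ℝ}
    {u w : energySpace Ω bc} {b : L2 Ω} {η : ℝ} (hη : 0 ≤ η) (hu : BoundedBy M u)
    (hb : ∀ᵐ x ∂(volume.restrict Ω), |b x| ≤ B) (hM : 0 ≤ M) (hB : 0 ≤ B)
    (h : IsStep fnL gradL u b η w) : BoundedBy (M + η * B) w := by
  set R := M + η * B with hR
  obtain ⟨G, C, hG, hG', hpos, hneg, hzero⟩ := exists_isSmoothCutoff R (by positivity)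
  -- Test with `G(w)`. As `G' ≥ 0`, the gradient term has a sign, so the integral of `(w - (u - η
  -- b)) G(w)` is at most zero. The integrand is nonnegative because `|u - η b| ≤ R`; it therefore
  -- vanishes almost everywhere, which excludes `|w| > R`.
  obtain ⟨v, hv1, hv2⟩ := hG.exists_mem_energySpace hΩ w
  have hgrad : 0 ≤ inner ℝ (grad w) (grad v) := by
    rw [L2.inner_def]
    refine integral_nonneg_of_ae ?_
    filter_upwards [hv2] with x hx
    rw [hx, inner_smul_right, real_inner_self_eq_norm_sq]
    exact mul_nonneg (hG' _) (sq_nonneg _)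
  have h1 : inner ℝ (fn w - fn u + η • b) (fn v) ≤ (0 : ℝ) := by
    have h2 := h v
    rw [inner_add_left, real_inner_smul_left]
    simp only [fnL_apply, gradL_apply] at h2
    rw [h2]
    nlinarith [mul_nonneg hη hgrad]
  have hae : ∀ᵐ x ∂(volume.restrict Ω),
      inner ℝ ((fn w - fn u + η • b : L2 Ω) x) (fn v x)
        = (fn w x - (fn u x - η * b x)) * G (fn w x) := by
    filter_upwards [hv1, Lp.coeFn_add (fn w - fn u) (η • b), Lp.coeFn_sub (fn w) (fn u),
      Lp.coeFn_smul η b] with x a1 a2 a3 a4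
    rw [a1, a2, Pi.add_apply, a3, a4, Pi.sub_apply, Pi.smul_apply, smul_eq_mul]
    simp only [RCLike.inner_apply, conj_trivial]
    ring
  have hk : ∀ᵐ x ∂(volume.restrict Ω), |fn u x - η * b x| ≤ R := by
    filter_upwards [hu, hb] with x h1 h2
    refine (abs_sub _ _).trans (add_le_add h1 ?_)
    rw [abs_mul, abs_of_nonneg hη]
    gcongr
  have hGz : ∀ s, |s| ≤ R ∨ 0 < G s ∧ R < s ∨ G s < 0 ∧ s < -R := by
    intro s
    by_cases hs : |s| ≤ R
    · exact Or.inl hs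
    · rcases lt_abs.1 (not_le.1 hs) with h | h
      · exact Or.inr (Or.inl ⟨hpos s h, h⟩)
      · exact Or.inr (Or.inr ⟨hneg s (by linarith), by linarith⟩)
  have hnn : 0 ≤ᵐ[volume.restrict Ω]
      fun x => inner ℝ ((fn w - fn u + η • b : L2 Ω) x) (fn v x) := by
    filter_upwards [hae, hk] with x h1 h2
    rw [h1]
    obtain ⟨h3, h4⟩ := abs_le.1 h2
    rcases le_or_gt (|fn w x|) R with h | h
    · simp [hzero _ h]
    · rcases lt_abs.1 h with h | h
      · exact mul_nonneg (by linarith) (hpos _ h).le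
      · exact mul_nonneg_of_nonpos_of_nonpos (by linarith) (hneg _ (by linarith)).le
  have hz : ∫ x in Ω, inner ℝ ((fn w - fn u + η • b : L2 Ω) x) (fn v x) = 0 :=
    le_antisymm (by rw [← L2.inner_def (𝕜 := ℝ)]; exact h1) (integral_nonneg_of_ae hnn)
  rw [integral_eq_zero_iff_of_nonneg_ae hnn (L2.integrable_inner _ _)] at hz
  filter_upwards [hz, hae, hk] with x h1 h2 h3
  rw [h2] at h1
  obtain ⟨h4, h5⟩ := abs_le.1 h3
  rcases hGz (fn w x) with h | ⟨h, h'⟩ | ⟨h, h'⟩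
  · exact h
  · exact absurd h1 (mul_pos (by linarith) h).ne'
  · exact absurd h1 (mul_pos_of_neg_of_neg (by linarith) h).ne'

end GradientFlow

/-! ### Superposition operators, energy balance and the uniform rate of decrease. -/

namespace GradientFlow

variable {d : ℕ} {Ω : Set (Space d)} {bc : BoundaryCondition d}

open Classical in
/-- The function `f(u)` as an element of `L²`, for bounded `u`. -/
noncomputable def nemytskii (f : ℝ → ℝ) (u : energySpace Ω bc) : L2 Ω :=
  if h : MemLp (fun x => f (fn u x)) 2 (volume.restrict Ω) then h.toLp _ else 0

theorem tendsto_norm_fn_sub (u : energySpace Ω bc) :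
    Tendsto (fun v : energySpace Ω bc => ‖fn v - fn u‖) (𝓝 u) (𝓝 0) :=
  tendsto_iff_norm_sub_tendsto_zero.1 ((fnL (Ω := Ω) (bc := bc)).continuous.tendsto u)

variable [IsFiniteMeasure (volume.restrict Ω)]

theorem BoundedBy.coeFn_nemytskii {M : ℝ} {u : energySpace Ω bc} (h : BoundedBy M u) {f : ℝ → ℝ}
    (hf : Continuous f) : nemytskii f u =ᵐ[volume.restrict Ω] fun x => f (fn u x) := by
  rw [nemytskii, dif_pos (h.memLp_comp hf)]
  exact MemLp.coeFn_toLp _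

/-- The constant function one in `L²`. -/
noncomputable def oneL2 (Ω : Set (Space d)) [IsFiniteMeasure (volume.restrict Ω)] : L2 Ω :=
  (memLp_const (1 : ℝ)).toLp _

theorem coeFn_oneL2 : oneL2 Ω =ᵐ[volume.restrict Ω] fun _ => (1 : ℝ) :=
  MemLp.coeFn_toLp _

theorem norm_nemytskii_sub_le {M σ K : ℝ} (hσ : 0 ≤ σ) (hK : 0 ≤ K) {f : ℝ → ℝ} (hf : Continuous f)
    (hmod : ∀ a b, |a| ≤ M → |b| ≤ M → |f a - f b| ≤ σ + K * |a - b|)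
    {u v : energySpace Ω bc} (hu : BoundedBy M u) (hv : BoundedBy M v) :
    ‖nemytskii f u - nemytskii f v‖ ≤ σ * ‖oneL2 Ω‖ + K * ‖fn u - fn v‖ := by
  have h1 : ‖nemytskii f u - nemytskii f v‖ ≤ ‖σ • oneL2 Ω + K • |fn u - fn v|‖ := by
    refine Lp.norm_le_norm_of_ae_le ?_
    filter_upwards [hu, hv, hu.coeFn_nemytskii hf, hv.coeFn_nemytskii hf, coeFn_oneL2 (Ω := Ω),
      Lp.coeFn_sub (nemytskii f u) (nemytskii f v), Lp.coeFn_sub (fn u) (fn v),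
      Lp.coeFn_add (σ • oneL2 Ω) (K • |fn u - fn v|), Lp.coeFn_smul σ (oneL2 Ω),
      Lp.coeFn_smul K |fn u - fn v|, Lp.coeFn_abs (fn u - fn v)]
      with x b1 b2 a1 a2 a3 a4 a5 a6 a7 a8 a9
    rw [a4, a6, Pi.sub_apply, Pi.add_apply, a7, a8, Pi.smul_apply, Pi.smul_apply, a9, a5, a1, a2,
      a3, Pi.sub_apply, smul_eq_mul, smul_eq_mul, mul_one, Real.norm_eq_abs]
    exact (hmod _ _ b1 b2).trans (le_abs_self _)
  refine h1.trans ((norm_add_le _ _).trans ?_)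
  rw [norm_smul, norm_smul, Real.norm_of_nonneg hσ, Real.norm_of_nonneg hK, norm_abs_eq_norm]

/-- Without growth conditions on `f`, continuity is sought only along functions with a common bound.
There the linear modulus applies: `σ` is fixed first, to cost at most `ε / 2`, and the `K` term
vanishes by `L²` convergence. -/
theorem continuousWithinAt_nemytskii {M : ℝ} {f : ℝ → ℝ} (hf : Continuous f)
    {u : energySpace Ω bc} (hu : BoundedBy M u) :
    ContinuousWithinAt (nemytskii f) {v : energySpace Ω bc | BoundedBy M v} u := by
  rw [ContinuousWithinAt, Metric.tendsto_nhds]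
  intro ε hε
  obtain ⟨K, hK, hmod⟩ := exists_abs_sub_le_add_mul hf M
    (σ := ε / (2 * (‖oneL2 Ω‖ + 1))) (by positivity)
  have hfn : Tendsto (fun v : energySpace Ω bc => K * ‖fn v - fn u‖)
      (𝓝[{v : energySpace Ω bc | BoundedBy M v}] u) (𝓝 0) := by
    simpa using ((tendsto_norm_fn_sub u).const_mul K).mono_left nhdsWithin_le_nhds
  filter_upwards [self_mem_nhdsWithin, hfn.eventually (gt_mem_nhds (half_pos hε))] with v hv h1
  rw [dist_eq_norm]
  have h2 := norm_nemytskii_sub_le (by positivity) hK hf hmod hv hu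
  have h3 : ε / (2 * (‖oneL2 Ω‖ + 1)) * ‖oneL2 Ω‖ ≤ ε / 2 := by
    rw [div_mul_eq_mul_div, div_le_div_iff₀ (by positivity) two_pos]
    nlinarith [norm_nonneg (oneL2 Ω)]
  linarith

theorem BoundedBy.energy_eq {M : ℝ} {w : energySpace Ω bc} (hw : BoundedBy M w) {F : ℝ → ℝ}
    (hF : Continuous F) :
    energy F w = 1 / 2 * ‖grad w‖ ^ 2 + inner ℝ (oneL2 Ω) (nemytskii F w) := by
  have h1 : Integrable (fun x => 1 / 2 * ‖grad w x‖ ^ 2) (volume.restrict Ω) :=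
    ((Lp.memLp (grad w)).integrable_norm_pow (by simp)).const_mul _
  have h2 : Integrable (fun x => F (fn w x)) (volume.restrict Ω) :=
    memLp_one_iff_integrable.1 (hw.memLp_comp hF)
  rw [energy, integral_add h1 h2, integral_const_mul, ← real_inner_self_eq_norm_sq, L2.inner_def,
    L2.inner_def]
  simp_rw [real_inner_self_eq_norm_sq]
  congr 1
  refine integral_congr_ae ?_
  filter_upwards [hw.coeFn_nemytskii hF, coeFn_oneL2 (Ω := Ω)] with x a1 a2
  rw [a1, a2]
  simp

theorem continuousWithinAt_energy {M : ℝ} {F : ℝ → ℝ} (hF : Continuous F)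
    {u : energySpace Ω bc} (hu : BoundedBy M u) :
    ContinuousWithinAt (energy F) {v : energySpace Ω bc | BoundedBy M v} u := by
  have h1 : ContinuousWithinAt (fun w : energySpace Ω bc =>
      1 / 2 * ‖gradL w‖ ^ 2 + inner ℝ (oneL2 Ω) (nemytskii F w))
      {v : energySpace Ω bc | BoundedBy M v} u := by
    refine ContinuousWithinAt.add
      (continuous_const.mul (gradL.continuous.norm.pow 2)).continuousWithinAt ?_
    exact continuousWithinAt_const.inner (continuousWithinAt_nemytskii hF hu)
  exact h1.congr (fun w hw => BoundedBy.energy_eq hw hF) (hu.energy_eq hF)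

/-- The nonlinear part of the energy difference, linearised at `u`. -/
theorem inner_one_nemytskii_sub_le {F f : ℝ → ℝ} (hF : ∀ z, HasDerivAt F (f z) z)
    (hf : Continuous f) {R σ K : ℝ} (hσ : 0 ≤ σ) (hK : 0 ≤ K)
    (hmod : ∀ a b, |a| ≤ R → |b| ≤ R → |f a - f b| ≤ σ + K * |a - b|)
    {u w₁ w₂ : energySpace Ω bc} (hu : BoundedBy R u) (h₁ : BoundedBy R w₁)
    (h₂ : BoundedBy R w₂) :
    inner ℝ (oneL2 Ω) (nemytskii F w₂) - inner ℝ (oneL2 Ω) (nemytskii F w₁)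
      - inner ℝ (nemytskii f u) (fn w₂ - fn w₁) ≤
    (σ * ‖oneL2 Ω‖ + K * (‖fn w₁ - fn u‖ + ‖fn w₂ - fn u‖)) * ‖fn w₂ - fn w₁‖ := by
  have hFc : Continuous F := continuous_iff_continuousAt.2 fun z => (hF z).continuousAt
  set Θ : L2 Ω := σ • oneL2 Ω + K • (|fn w₁ - fn u| + |fn w₂ - fn u|) with hΘ
  have hle : inner ℝ (oneL2 Ω) (nemytskii F w₂) - inner ℝ (oneL2 Ω) (nemytskii F w₁)
      - inner ℝ (nemytskii f u) (fn w₂ - fn w₁) ≤ inner ℝ Θ |fn w₂ - fn w₁| := by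
    simp only [L2.inner_def]
    have i1 : Integrable (fun x => inner ℝ (oneL2 Ω x) (nemytskii F w₁ x)) (volume.restrict Ω) :=
      L2.integrable_inner (𝕜 := ℝ) _ _
    have i2 : Integrable (fun x => inner ℝ (oneL2 Ω x) (nemytskii F w₂ x)) (volume.restrict Ω) :=
      L2.integrable_inner (𝕜 := ℝ) _ _
    have i3 : Integrable (fun x => inner ℝ (nemytskii f u x) ((fn w₂ - fn w₁ : L2 Ω) x))
      (volume.restrict Ω) := L2.integrable_inner (𝕜 := ℝ) _ _
    have i4 : Integrable (fun x => inner ℝ (Θ x) (|fn w₂ - fn w₁| x)) (volume.restrict Ω) :=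
      L2.integrable_inner (𝕜 := ℝ) _ _
    have i21 : Integrable (fun x => inner ℝ (oneL2 Ω x) (nemytskii F w₂ x)
      - inner ℝ (oneL2 Ω x) (nemytskii F w₁ x)) (volume.restrict Ω) := i2.sub i1
    rw [← integral_sub i2 i1, ← integral_sub i21 i3]
    refine integral_mono_ae (i21.sub i3) i4 ?_
    filter_upwards [hu, h₁, h₂, hu.coeFn_nemytskii hf, h₁.coeFn_nemytskii hFc,
      h₂.coeFn_nemytskii hFc, coeFn_oneL2 (Ω := Ω), Lp.coeFn_sub (fn w₂) (fn w₁),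
      Lp.coeFn_sub (fn w₁) (fn u), Lp.coeFn_sub (fn w₂) (fn u),
      Lp.coeFn_add (σ • oneL2 Ω) (K • (|fn w₁ - fn u| + |fn w₂ - fn u|)),
      Lp.coeFn_smul σ (oneL2 Ω), Lp.coeFn_smul K (|fn w₁ - fn u| + |fn w₂ - fn u|),
      Lp.coeFn_add |fn w₁ - fn u| |fn w₂ - fn u|, Lp.coeFn_abs (fn w₁ - fn u),
      Lp.coeFn_abs (fn w₂ - fn u), Lp.coeFn_abs (fn w₂ - fn w₁)]
      with x b1 b2 b3 a1 a2 a3 a4 a5 a6 a7 a8 a9 a10 a11 a12 a13 a14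
    have hΘx : Θ x = σ + K * (|fn w₁ x - fn u x| + |fn w₂ x - fn u x|) := by
      rw [hΘ, a8, Pi.add_apply, a9, a10, Pi.smul_apply, Pi.smul_apply, a11, Pi.add_apply, a12, a13,
        a6, a7, a4]
      simp
    simp only [RCLike.inner_apply, conj_trivial]
    rw [hΘx, a14, a5, a1, a2, a3, a4, Pi.sub_apply]
    have := (le_abs_self _).trans (abs_taylor_le hF hK hmod b2 b3 b1)
    linarith
  refine hle.trans ((real_inner_le_norm _ _).trans ?_)
  rw [norm_abs_eq_norm]
  gcongr
  refine (norm_add_le _ _).trans ?_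
  rw [norm_smul, norm_smul, Real.norm_of_nonneg hσ, Real.norm_of_nonneg hK]
  gcongr
  refine (norm_add_le _ _).trans ?_
  rw [norm_abs_eq_norm, norm_abs_eq_norm]

/-- Energy balance between two multipliers. -/
theorem IsStep.energy_sub_le {F f : ℝ → ℝ} (hF : ∀ z, HasDerivAt F (f z) z)
    (hf : Continuous f) {R σ K : ℝ} (hσ : 0 ≤ σ) (hK : 0 ≤ K)
    (hmod : ∀ a b, |a| ≤ R → |b| ≤ R → |f a - f b| ≤ σ + K * |a - b|)
    {u w₁ w₂ : energySpace Ω bc} (hu : BoundedBy R u) (h₁ : BoundedBy R w₁)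
    (h₂ : BoundedBy R w₂) {η₁ η₂ : ℝ} (h0 : 0 ≤ η₁) (h12 : η₁ < η₂)
    (hs₁ : IsStep fnL gradL u (nemytskii f u) η₁ w₁)
    (hs₂ : IsStep fnL gradL u (nemytskii f u) η₂ w₂) :
    energy F w₂ - energy F w₁ ≤ -(‖fn w₂ - fn w₁‖ ^ 2 / (η₂ - η₁)) +
      (σ * ‖oneL2 Ω‖ + K * (‖fn w₁ - fn u‖ + ‖fn w₂ - fn u‖)) * ‖fn w₂ - fn w₁‖ := by
  have hFc : Continuous F := continuous_iff_continuousAt.2 fun z => (hF z).continuousAt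
  have e1 := hs₁.decrease h0 h12 hs₂
  have e2 := inner_one_nemytskii_sub_le hF hf hσ hK hmod hu h₁ h₂
  rw [map_sub] at e1
  simp only [fnL_apply, gradL_apply] at e1
  rw [h₁.energy_eq hFc, h₂.energy_eq hFc]
  linarith

/-- From `X ≥ c h` follows `X² / h ≥ c X`; half of this pays for `A X`, and the remaining `c X / 2`
is at least `c² h / 2`. -/
theorem le_of_speed_le {E X A c h : ℝ} (hc : 0 ≤ c) (hh : 0 < h) (hE : E ≤ -(X ^ 2 / h) + A * X)
    (hA : A ≤ c / 2) (hX : c * h ≤ X) : E ≤ -(c ^ 2 / 2 * h) := by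
  have hX0 : 0 ≤ X := (mul_nonneg hc hh.le).trans hX
  have e4 : c * X ≤ X ^ 2 / h := by
    rw [le_div_iff₀ hh]
    nlinarith
  have e5 := mul_le_mul_of_nonneg_right hA hX0
  have e6 := mul_le_mul_of_nonneg_left hX hc
  linarith

set_option maxHeartbeats 800000 in
/-- Near `φ` the energy decreases along the correction path with a uniform rate. -/
theorem exists_uniform_energy_decrease (hΩ : IsOpen Ω) {F f : ℝ → ℝ}
    (hF : ∀ z, HasDerivAt F (f z) z) (hf : Continuous f) {φ : energySpace Ω bc} {M : ℝ}
    (hM : 0 ≤ M) (hφ : BoundedBy M φ) {ε : ℝ} (hε : 0 < ε) (hres : ResidualSqGE f φ ε) :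
    ∃ c > 0, ∃ ηmax > 0, ∃ R, ∀ᶠ u in 𝓝[{u : energySpace Ω bc | BoundedBy M u}] φ,
      ∃ W : ℝ → energySpace Ω bc, W 0 = u ∧
        (∀ η, 0 ≤ η → IsStep fnL gradL u (nemytskii f u) η (W η)) ∧
        (∀ η ∈ Icc 0 ηmax, BoundedBy R (W η)) ∧
        ContinuousOn (fun η => energy F (W η)) (Icc 0 ηmax) ∧
        ∀ η₁ η₂, 0 ≤ η₁ → η₁ ≤ η₂ → η₂ ≤ ηmax →
          energy F (W η₂) + c * (η₂ - η₁) ≤ energy F (W η₁) := by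
  have hFc : Continuous F := continuous_iff_continuousAt.2 fun z => (hF z).continuousAt
  have hinj : ∀ v : energySpace Ω bc, fnL v = 0 → v = 0 := fun v hv => fn_injective hΩ hv
  have : CompleteSpace (energySpace Ω bc) := isClosed_energySpace.completeSpace_coe
  -- the residual does not vanish
  have hne : ∃ v : energySpace Ω bc,
      inner ℝ (gradL φ) (gradL v) + inner ℝ (nemytskii f φ) (fnL v) ≠ (0 : ℝ) := by
    by_contra! hcon
    have hr : IsResidual f φ 0 := by
      intro v
      rw [integral_mul_eq_inner (hφ.coeFn_nemytskii hf) (fn v),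
        integral_mul_eq_inner (Filter.EventuallyEq.rfl) (fn v), inner_zero_left]
      exact hcon v
    have := hres 0 hr
    rw [norm_zero] at this
    linarith
  obtain ⟨c, hc, ρ, hρ, hlow⟩ :=
    exists_le_norm_sub_of_functional_ne_zero inner_energySpace hinj hne
  obtain ⟨B, hB⟩ := (isCompact_Icc (a := -M) (b := M)).exists_bound_of_continuousOn hf.continuousOn
  have hB0 : 0 ≤ B := (norm_nonneg _).trans (hB 0 ⟨by linarith, hM⟩)
  -- The bound given by the maximum principle for `η ≤ 1`.
  obtain ⟨R, hR⟩ : ∃ R, R = M + B := ⟨_, rfl⟩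
  obtain ⟨m, hm⟩ : ∃ m, m = ‖oneL2 Ω‖ := ⟨_, rfl⟩
  have hm0 : 0 ≤ m := hm ▸ norm_nonneg _
  -- The remainder coefficient `σ m + K (s + s)` must not exceed `c / 2`; `σ` and the radius `s`
  -- below each take `c / 4`. Also `s ≤ ρ / 2`, so that the path stays within `ρ` of `φ` when `u` is
  -- within `ρ / 2`.
  obtain ⟨σ, hσ⟩ : ∃ σ, σ = c / (4 * (m + 1)) := ⟨_, rfl⟩
  have hσ0 : 0 < σ := by rw [hσ]; positivity
  have hσm : σ * m ≤ c / 4 := by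
    rw [hσ, div_mul_eq_mul_div, div_le_div_iff₀ (by positivity) (by norm_num)]
    nlinarith
  obtain ⟨K, hK, hmod⟩ := exists_abs_sub_le_add_mul hf R hσ0
  obtain ⟨s, hs⟩ : ∃ s, s = min (c / (8 * (K + 1))) (ρ / 2) := ⟨_, rfl⟩
  have hs0 : 0 < s := by rw [hs]; positivity
  have hKs : K * (s + s) ≤ c / 4 := by
    have h1 : s * (8 * (K + 1)) ≤ c := by
      rw [← le_div_iff₀ (by positivity)]
      exact hs.le.trans (min_le_left _ _)
    nlinarith
  -- `Q` bounds `‖∇u‖² + ‖f(u)‖²` for all `u` near `φ`; with `ηmax * Q ≤ s ^ 2` the path stays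
  -- within `s` of `u`.
  obtain ⟨Q, hQ⟩ : ∃ Q, Q = (‖grad φ‖ + 1) ^ 2 + (‖nemytskii f φ‖ + 1) ^ 2 := ⟨_, rfl⟩
  have hQ0 : 0 < Q := by rw [hQ]; positivity
  obtain ⟨ηmax, hη⟩ : ∃ η, η = min 1 (min ρ (s ^ 2 / Q)) := ⟨_, rfl⟩
  have hη0 : 0 < ηmax := by rw [hη]; positivity
  have hη1 : ηmax ≤ 1 := hη.le.trans (min_le_left _ _)
  have hηρ : ηmax ≤ ρ := hη.le.trans ((min_le_right _ _).trans (min_le_left _ _))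
  have hηQ : ηmax * Q ≤ s ^ 2 := by
    rw [← le_div_iff₀ hQ0]
    exact hη.le.trans ((min_le_right _ _).trans (min_le_right _ _))
  refine ⟨c ^ 2 / 2, by positivity, ηmax, hη0, R, ?_⟩
  have hfnφ : ∀ᶠ u in 𝓝[{u : energySpace Ω bc | BoundedBy M u}] φ, ‖fn u - fn φ‖ < ρ / 2 := by
    exact ((tendsto_norm_fn_sub φ).mono_left nhdsWithin_le_nhds).eventually
      (gt_mem_nhds (half_pos hρ))
  have hgrφ : ∀ᶠ u in 𝓝[{u : energySpace Ω bc | BoundedBy M u}] φ, ‖grad u‖ < ‖grad φ‖ + 1 := by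
    have h1 : Continuous fun v : energySpace Ω bc => ‖gradL v‖ := gradL.continuous.norm
    exact ((h1.tendsto φ).mono_left nhdsWithin_le_nhds).eventually
      (gt_mem_nhds (lt_add_one ‖gradL φ‖))
  have hneφ : ∀ᶠ u in 𝓝[{u : energySpace Ω bc | BoundedBy M u}] φ,
      ‖nemytskii f u - nemytskii f φ‖ < min 1 ρ := by
    have h1 := Metric.tendsto_nhds.1 (continuousWithinAt_nemytskii hf hφ) (min 1 ρ) (by positivity)
    simpa only [dist_eq_norm] using h1
  filter_upwards [self_mem_nhdsWithin, hfnφ, hgrφ, hneφ] with u hu h1 h2 h3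
  have hu : BoundedBy M u := hu
  have hMR : M ≤ R := hR ▸ le_add_of_nonneg_right hB0
  have hbB : ∀ᵐ x ∂(volume.restrict Ω), |nemytskii f u x| ≤ B := by
    filter_upwards [hu, hu.coeFn_nemytskii hf] with x a1 a2
    rw [a2]
    exact hB _ (abs_le.1 a1)
  have hex : ∀ η : ℝ, ∃ w : energySpace Ω bc,
      0 ≤ η → IsStep fnL gradL u (nemytskii f u) η w := by
    intro η
    by_cases h : 0 ≤ η
    · obtain ⟨w, hw⟩ := exists_isStep inner_energySpace u (nemytskii f u) h
      exact ⟨w, fun _ => hw⟩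
    · exact ⟨0, fun h' => absurd h' h⟩
  choose W hW using hex
  have hbound : ∀ η ∈ Icc 0 ηmax, BoundedBy R (W η) := by
    intro η hηm
    refine ((hW η hηm.1).boundedBy hΩ hηm.1 hu hbB hM hB0).mono ?_
    rw [hR]
    gcongr
    exact mul_le_of_le_one_left hB0 (hηm.2.trans hη1)
  have hnear : ∀ η ∈ Icc 0 ηmax, ‖fn (W η) - fn u‖ ≤ s := by
    intro η hηm
    have h4 := (hW η hηm.1).norm_sub_sq_le hηm.1
    simp only [fnL_apply, gradL_apply] at h4
    have h5 : ‖nemytskii f u‖ ≤ ‖nemytskii f φ‖ + 1 := by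
      have := norm_sub_norm_le (nemytskii f u) (nemytskii f φ)
      linarith [min_le_left 1 ρ]
    refine le_of_sq_le_sq ?_ hs0.le
    calc ‖fn (W η) - fn u‖ ^ 2 ≤ η * ‖grad u‖ ^ 2 + η ^ 2 * ‖nemytskii f u‖ ^ 2 := h4
      _ ≤ η * (‖grad φ‖ + 1) ^ 2 + η * (‖nemytskii f φ‖ + 1) ^ 2 := by
          have h6 : η ^ 2 ≤ η := pow_le_of_le_one hηm.1 (hηm.2.trans hη1) two_ne_zero
          have := hηm.1
          gcongr
      _ = η * Q := by rw [hQ]; ring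
      _ ≤ ηmax * Q := by gcongr; exact hηm.2
      _ ≤ s ^ 2 := hηQ
  refine ⟨W, ?_, hW, hbound, ?_, ?_⟩
  · exact IsStep.unique hinj le_rfl (hW 0 le_rfl) fun v => by simp
  · have hWc := continuousOn_step inner_energySpace hinj hW
    intro η hηm
    refine ContinuousWithinAt.comp (g := energy F) (f := W)
      (t := {v : energySpace Ω bc | BoundedBy R v})
      (continuousWithinAt_energy hFc (hbound η hηm))
      ((hWc η hηm.1).mono Icc_subset_Ici_self) fun η' hη' => hbound η' hη'
  · intro η₁ η₂ h01 h12 h2m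
    rcases h12.eq_or_lt with rfl | hlt
    · simp
    have m1 : η₁ ∈ Icc 0 ηmax := ⟨h01, h12.trans h2m⟩
    have m2 : η₂ ∈ Icc 0 ηmax := ⟨h01.trans h12, h2m⟩
    have hh : 0 < η₂ - η₁ := sub_pos.2 hlt
    have e1 := IsStep.energy_sub_le hF hf hσ0.le hK hmod (hu.mono hMR) (hbound _ m1)
      (hbound _ m2) h01 hlt (hW _ m1.1) (hW _ m2.1)
    have e2 : c * (η₂ - η₁) ≤ ‖fn (W η₂) - fn (W η₁)‖ := by
      have h5 : ‖fn (W η₁) - fn φ‖ ≤ ρ := by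
        have h6 := norm_add_le (fn (W η₁) - fn u) (fn u - fn φ)
        rw [sub_add_sub_cancel] at h6
        have h7 : s ≤ ρ / 2 := hs.le.trans (min_le_right _ _)
        linarith [hnear _ m1]
      have := hlow u (nemytskii f u) η₁ η₂ (W η₁) (W η₂) h01 hlt (h2m.trans hηρ) h5
        (h3.le.trans (min_le_right _ _)) (hW _ m1.1) (hW _ m2.1)
      rwa [map_sub] at this
    have n1 := hnear _ m1
    have n2 := hnear _ m2
    have e3 : σ * m + K * (‖fn (W η₁) - fn u‖ + ‖fn (W η₂) - fn u‖) ≤ c / 2 := by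
      have : K * (‖fn (W η₁) - fn u‖ + ‖fn (W η₂) - fn u‖) ≤ K * (s + s) :=
        mul_le_mul_of_nonneg_left (add_le_add n1 n2) hK
      linarith only [this, hσm, hKs]
    rw [← hm] at e1
    have e4 := le_of_speed_le hc.le hh e1 e3 e2
    linarith only [e4]

end GradientFlow

/-! ### Existence, uniqueness and smallness of the multiplier. -/

namespace GradientFlow

/-- Solution of the energy-correction system, given a path of steps along which the energy
decreases at a uniform rate. -/
theorem exists_unique_energyCorrection {d : ℕ} {Ω : Set (Space d)} {bc : BoundaryCondition d}
    [IsFiniteMeasure (volume.restrict Ω)] (hΩ : IsOpen Ω) {F f : ℝ → ℝ} (hF : Continuous F)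
    (hf : Continuous f) {φ u : energySpace Ω bc} {M R c ηmax : ℝ} (hu : BoundedBy M u)
    (hc : 0 < c) (hη : 0 < ηmax) {W : ℝ → energySpace Ω bc} (hW0 : W 0 = u)
    (hW : ∀ η, 0 ≤ η → IsStep fnL gradL u (nemytskii f u) η (W η))
    (hWb : ∀ η ∈ Icc 0 ηmax, BoundedBy R (W η))
    (hWc : ContinuousOn (fun η => energy F (W η)) (Icc 0 ηmax))
    (hWd : ∀ η₁ η₂, 0 ≤ η₁ → η₁ ≤ η₂ → η₂ ≤ ηmax →
      energy F (W η₂) + c * (η₂ - η₁) ≤ energy F (W η₁))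
    (hE : energy F u - energy F φ < c * ηmax) :
    ∃ (η : ℝ) (w : energySpace Ω bc), (IsEnergyCorrection F f φ u η w ∧ η ≤ ηmax ∧
      ∀ η' w', IsEnergyCorrection F f φ u η' w' → η' ≤ ηmax → η' = η ∧ w' = w) ∧
      c * η ≤ max 0 (energy F u - energy F φ) := by
  have hinj : ∀ v : energySpace Ω bc, fnL v = 0 → v = 0 := fun v hv => fn_injective hΩ hv
  have hb := hu.coeFn_nemytskii hf
  -- every solution lies on the path
  have hpath : ∀ η' w', IsEnergyCorrection F f φ u η' w' → w' = W η' := fun η' w' h =>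
    IsStep.unique hinj h.nonneg ((isStep_iff hb).2 h.equation) (hW η' h.nonneg)
  have hsol : ∀ η ∈ Icc 0 ηmax, energy F (W η) - energy F φ ≤ 0 →
      η * (energy F (W η) - energy F φ) = 0 → IsEnergyCorrection F f φ u η (W η) :=
    fun η hη h1 h2 => ⟨(isStep_iff hb).1 (hW η hη.1),
      memLp_one_iff_integrable.1 ((hWb η hη).memLp_comp hF), hη.1, h1, h2⟩
  have h0m : (0 : ℝ) ∈ Icc 0 ηmax := ⟨le_rfl, hη.le⟩
  rcases le_or_gt (energy F u - energy F φ) 0 with hle | hgt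
  · refine ⟨0, W 0, ⟨hsol 0 h0m (by rwa [hW0]) (zero_mul _), hη.le, fun η' w' h' hη' => ?_⟩, ?_⟩
    · have hw' := hpath η' w' h'
      rcases h'.nonneg.eq_or_lt with h | h
      · rw [hw', ← h]
        exact ⟨rfl, rfl⟩
      -- A positive multiplier would force equality of energies, but the path has by then dropped
      -- strictly below `energy F u`, hence below `energy F φ`.
      · exfalso
        have h1 := (mul_eq_zero.1 h'.complementarity).resolve_left h.ne'
        have h2 := hWd 0 η' le_rfl h.le hη'
        rw [hW0, ← hw'] at h2
        nlinarith [mul_pos hc h]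
    · rw [mul_zero]
      exact le_max_left _ _
  · have hmax := hWd 0 ηmax le_rfl hη.le le_rfl
    rw [hW0] at hmax
    -- By `hE` the guaranteed drop over the whole interval exceeds the initial excess, so the level
    -- of `φ` is crossed.
    obtain ⟨η, hηm, hEη⟩ := intermediate_value_Icc' hη.le hWc
      (show energy F φ ∈ Icc (energy F (W ηmax)) (energy F (W 0)) by
        rw [hW0]
        exact ⟨by linarith, by linarith⟩)
    have hEη' : energy F (W η) = energy F φ := hEη
    refine ⟨η, W η, ⟨hsol η hηm (by rw [hEη', sub_self]) (by rw [hEη', sub_self, mul_zero]),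
      hηm.2, fun η' w' h' hη' => ?_⟩, ?_⟩
    · have hw' := hpath η' w' h'
      suffices hηη : η' = η by
        rw [hw', hηη]
        exact ⟨rfl, rfl⟩
      have hpos : 0 < η' := by
        refine lt_of_le_of_ne h'.nonneg fun h => ?_
        have h1 := h'.energy_le
        rw [hw', ← h, hW0] at h1
        linarith
      have h1 := (mul_eq_zero.1 h'.complementarity).resolve_left hpos.ne'
      rw [hw'] at h1
      rcases lt_trichotomy η' η with h | h | h
      · have h2 := hWd η' η hpos.le h.le hηm.2
        nlinarith [mul_pos hc (sub_pos.2 h)]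
      · exact h
      · have h2 := hWd η η' hηm.1 h.le hη'
        nlinarith [mul_pos hc (sub_pos.2 h)]
    · have h2 := hWd 0 η le_rfl hηm.1 hηm.2
      rw [hW0] at h2
      exact le_max_of_le_right (by linarith)

end GradientFlow

theorem mainTheorem3 {d : ℕ} (Ω : Set (GradientFlow.Space d)) (hΩ : IsOpen Ω)
    (hΩb : Bornology.IsBounded Ω)
    (bc : GradientFlow.BoundaryCondition d) (hbc : bc.Compatible Ω)
    (F f : ℝ → ℝ) (hF : ∀ z, HasDerivAt F (f z) z) (hf : Continuous f)
    (Φ : ℝ → GradientFlow.energySpace Ω bc → GradientFlow.energySpace Ω bc)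
    (φ : GradientFlow.energySpace Ω bc)
    (hφ : ∃ M, GradientFlow.BoundedBy M φ)
    (hΦ : Tendsto (fun τ => Φ τ φ) (𝓝[>] 0) (𝓝 φ))
    (hΦb : ∃ M, ∀ᶠ τ in 𝓝[>] (0 : ℝ), GradientFlow.BoundedBy M (Φ τ φ))
    (ε : ℝ) (hε : 0 < ε) (hres : GradientFlow.ResidualSqGE f φ ε) :
    ∃ τ₁ > 0, ∃ ηmax > 0, ∃ (η : ℝ → ℝ) (w : ℝ → GradientFlow.energySpace Ω bc),
      (∀ τ, 0 < τ → τ < τ₁ →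
        GradientFlow.IsEnergyCorrection F f φ (Φ τ φ) (η τ) (w τ) ∧ η τ ≤ ηmax ∧
        ∀ η' w', GradientFlow.IsEnergyCorrection F f φ (Φ τ φ) η' w' → η' ≤ ηmax →
          η' = η τ ∧ w' = w τ) ∧
      Tendsto η (𝓝[>] 0) (𝓝 0) := by
  open GradientFlow in
  have hFc : Continuous F := continuous_iff_continuousAt.2 fun z => (hF z).continuousAt
  have : IsFiniteMeasure (volume.restrict Ω) :=
    isFiniteMeasure_restrict.2 hΩb.measure_lt_top.ne
  obtain ⟨M₁, hM₁⟩ := hφ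
  obtain ⟨M₂, hM₂⟩ := hΦb
  -- One nonnegative bound for `φ` and all predictors, so that `H¹` convergence takes place in a set
  -- on which the energy is continuous.
  set M := max 0 (max M₁ M₂) with hM
  have hφM : BoundedBy M φ := hM₁.mono ((le_max_left _ _).trans (le_max_right _ _))
  have hΦM : ∀ᶠ τ in 𝓝[>] (0 : ℝ), BoundedBy M (Φ τ φ) :=
    hM₂.mono fun τ h => h.mono ((le_max_right _ _).trans (le_max_right _ _))
  have hΦ' : Tendsto (fun τ => Φ τ φ) (𝓝[>] 0) (𝓝[{u : energySpace Ω bc | BoundedBy M u}] φ) :=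
    tendsto_nhdsWithin_iff.2 ⟨hΦ, hΦM⟩
  obtain ⟨c, hc, ηmax, hη, R, hgood⟩ :=
    exists_uniform_energy_decrease hΩ hF hf (le_max_left _ _) hφM hε hres
  have hE : Tendsto (fun τ => energy F (Φ τ φ) - energy F φ) (𝓝[>] 0) (𝓝 0) := by
    simpa using ((continuousWithinAt_energy hFc hφM).tendsto.comp hΦ').sub_const (energy F φ)
  have hex : ∀ᶠ τ in 𝓝[>] (0 : ℝ), ∃ (η : ℝ) (w : energySpace Ω bc),
      (IsEnergyCorrection F f φ (Φ τ φ) η w ∧ η ≤ ηmax ∧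
        ∀ η' w', IsEnergyCorrection F f φ (Φ τ φ) η' w' → η' ≤ ηmax → η' = η ∧ w' = w) ∧
        c * η ≤ max 0 (energy F (Φ τ φ) - energy F φ) := by
    filter_upwards [hΦ'.eventually hgood, hΦM, hE.eventually (gt_mem_nhds (mul_pos hc hη))]
      with τ h1 h2 h3
    obtain ⟨W, hW0, hW, hWb, hWc, hWd⟩ := h1
    exact exists_unique_energyCorrection hΩ hFc hf h2 hc hη hW0 hW hWb hWc hWd h3
  obtain ⟨τ₁, hτ₁, hτ⟩ := mem_nhdsGT_iff_exists_Ioo_subset.1 hex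
  -- The estimate on `c * p.1` is selected together with the solution, since it yields the limit of
  -- the multiplier. Outside `(0, τ₁)` the value is arbitrary.
  have hsel : ∀ τ, ∃ p : ℝ × energySpace Ω bc, τ ∈ Ioo 0 τ₁ →
      (IsEnergyCorrection F f φ (Φ τ φ) p.1 p.2 ∧ p.1 ≤ ηmax ∧
        ∀ η' w', IsEnergyCorrection F f φ (Φ τ φ) η' w' → η' ≤ ηmax → η' = p.1 ∧ w' = p.2) ∧
        c * p.1 ≤ max 0 (energy F (Φ τ φ) - energy F φ) := by
    intro τ
    by_cases h : τ ∈ Ioo 0 τ₁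
    · obtain ⟨η, w, hηw⟩ := hτ h
      exact ⟨(η, w), fun _ => hηw⟩
    · exact ⟨(0, φ), fun h' => absurd h' h⟩
  choose p hp using hsel
  refine ⟨τ₁, hτ₁, ηmax, hη, fun τ => (p τ).1, fun τ => (p τ).2,
    fun τ h0 h1 => (hp τ ⟨h0, h1⟩).1, ?_⟩
  have hlim : Tendsto (fun τ => c⁻¹ * max 0 (energy F (Φ τ φ) - energy F φ)) (𝓝[>] 0) (𝓝 0) := by
    have := ((tendsto_const_nhds (x := (0 : ℝ))).max hE).const_mul c⁻¹
    simpa using this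
  refine squeeze_zero' ?_ ?_ hlim
  · filter_upwards [Ioo_mem_nhdsGT hτ₁] with τ h using (hp τ h).1.1.nonneg
  · filter_upwards [Ioo_mem_nhdsGT hτ₁] with τ h
    rw [le_inv_mul_iff₀ hc]
    exact (hp τ h).2
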